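/- **Dumbbell Theorem.** Tile the plane by unit squares with vertices in $\mathbb Z^2$. *Quadrilaterals, weights, optimality.* Let $D$ be a closed topological disk that is the union of finitely many tiles, with four distinct boundary points $a,b,c,d$ in clockwise order; they determine the top edge $ab$, the right edge $bc$, the bottom edge $cd$ and the left edge $da$. A *weight function* $\rho$ for $D$ is a nonnegative real function, not identically $0$, on the set of tiles of $D$. The $\rho$-length of a path in $D$ is the sum of the weights of the (closed) tiles that its image meets. The height $H_\rho$ is the minimal $\rho$-length of a path in $D$ joining the top edge to the bottom edge, and the area is $A_\rho=\sum_t\rho(t)^2$. A weight function is *fat flow optimal* if it maximizes $H_\rho^2/A_\rho$ among all weight functions for $D$. *Dumbbells.* The quadrilateral $D$ is a *dumbbell of bar height $n\ge 1$* if its tiles are partitioned into a left ball, a bar and a right ball, where * the bar is a rectangle of $n$ rows and $m\ge 6n$ columns of tiles; * each of the two balls may be empty; if the left (right) ball is not empty, then its intersection with the bar is a nonempty connected subset of the left (right) side of the bar; * the top side of the bar lies in the top edge of $D$ and the bottom side of the bar lies in the bottom edge of $D$; * the left (right) edge of $D$ lies in the union of the left (right) ball and the left (right) side of the bar; if the left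 (right) ball is empty, then the left (right) edge of $D$ is equal to the left (right) side of the bar. For a tile $t$ of the bar, the *skinny path distance* from $t$ to the balls is one less than the minimal length $k$ of a chain of tiles $t=t_1,t_2,\dots,t_k$ of $D$ such that $t_i\cap t_{i+1}\neq\emptyset$ for $1\le i<k$ and $t_k$ meets one of the balls; it is $\infty$ if there is no such chain (that is, if both balls are empty). *Theorem.* Let $D$ be a dumbbell of bar height $n$. Every fat flow optimal weight function $\rho$ for $D$ is *virtually bar uniform*: $\rho(t)=H_\rho/n$ for every tile $t$ of the bar whose skinny path distance to the balls is at least $3n$. -/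

import Mathlib

open Set

namespace SquareTiling

/-- The closed unit square of the square tiling of the plane whose lower left corner is `t`. -/
def tile (t : ℤ × ℤ) : Set (ℝ × ℝ) :=
  Icc (t.1 : ℝ) (t.1 + 1) ×ˢ Icc (t.2 : ℝ) (t.2 + 1)

/-- The subset of the plane that is covered by a finite set of tiles. -/
def region (S : Finset (ℤ × ℤ)) : Set (ℝ × ℝ) := ⋃ t ∈ S, tile t

/-- The standard quadrilateral `[0,1] × [0,1]`. -/
def unitSquare : Set (ℝ × ℝ) := Icc 0 1 ×ˢ Icc 0 1

/-- A square-tiled quadrilateral: a closed topological disk in the plane that is the union of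
finitely many tiles of the square tiling, with four distinct distinguished boundary points
`a, b, c, d` in cyclic order.  The disk is presented as the image of the standard square under an
embedding `param` of it into the plane, with
`a = param (0,1)`, `b = param (1,1)`, `c = param (1,0)`, `d = param (0,0)`.
(Every disk with four such points has such a parametrization; only the images of the four sides
of the standard square are used below.) -/
structure Quadrilateral where
  tiles : Finset (ℤ × ℤ)
  param : ℝ × ℝ → ℝ × ℝ
  continuousOn_param : ContinuousOn param unitSquare
  injOn_param : InjOn param unitSquare
  image_param : param '' unitSquare = region tiles

namespace Quadrilateral

variable (Q : Quadrilateral)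

/-- The underlying closed disk. -/
def carrier : Set (ℝ × ℝ) := region Q.tiles

/-- The edge `ab`. -/
def topEdge : Set (ℝ × ℝ) := Q.param '' (Icc 0 1 ×ˢ {1})

/-- The edge `bc`. -/
def rightEdge : Set (ℝ × ℝ) := Q.param '' ({1} ×ˢ Icc 0 1)

/-- The edge `cd`. -/
def bottomEdge : Set (ℝ × ℝ) := Q.param '' (Icc 0 1 ×ˢ {0})

/-- The edge `da`. -/
def leftEdge : Set (ℝ × ℝ) := Q.param '' ({0} ×ˢ Icc 0 1)

/-- A weight function: a nonnegative real-valued function on the set of tiles, not identically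
zero. -/
def IsWeight (ρ : Q.tiles → ℝ) : Prop := (∀ t, 0 ≤ ρ t) ∧ ρ ≠ 0

open Classical in
/-- The `ρ`-length of a path with image `W`: the sum of the weights of all (closed) tiles that
meet `W`. -/
noncomputable def length (ρ : Q.tiles → ℝ) (W : Set (ℝ × ℝ)) : ℝ :=
  ∑ t : Q.tiles with (tile t.1 ∩ W).Nonempty, ρ t

/-- The `ρ`-height `H_ρ`: the minimum of the `ρ`-lengths of the paths in `Q` that join the top
edge to the bottom edge.  (The set of these `ρ`-lengths is finite and nonempty, so that its
infimum is a minimum.) -/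
noncomputable def height (ρ : Q.tiles → ℝ) : ℝ :=
  sInf {l | ∃ x ∈ Q.topEdge, ∃ y ∈ Q.bottomEdge, ∃ γ : Path x y,
    range γ ⊆ Q.carrier ∧ l = Q.length ρ (range γ)}

/-- The `ρ`-area `A_ρ` of `Q`. -/
def area (ρ : Q.tiles → ℝ) : ℝ := ∑ t, ρ t ^ 2

/-- The fat flow modulus of `Q` with respect to `ρ`. -/
noncomputable def fatFlowModulus (ρ : Q.tiles → ℝ) : ℝ := Q.height ρ ^ 2 / Q.area ρ

/-- A fat flow optimal weight function: one that maximizes the fat flow modulus. -/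
def IsFatFlowOptimal (ρ : Q.tiles → ℝ) : Prop :=
  Q.IsWeight ρ ∧ ∀ σ, Q.IsWeight σ → Q.fatFlowModulus σ ≤ Q.fatFlowModulus ρ

/-- The list `c` is a chain of tiles of `Q` (nonempty, consecutive tiles have a common point)
that joins a point of `A` to a point of `B`. -/
def IsChainJoining (A B : Set (ℝ × ℝ)) (c : List (ℤ × ℤ)) : Prop :=
  (∀ t ∈ c, t ∈ Q.tiles) ∧
  c.IsChain (fun s t => (tile s ∩ tile t).Nonempty) ∧
  (∃ t ∈ c.head?, (tile t ∩ A).Nonempty) ∧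
  (∃ t ∈ c.getLast?, (tile t ∩ B).Nonempty)

/-- The skinny path distance between two subsets: one less than the minimum length of a chain of
tiles joining a point of `A` to a point of `B`; it is `⊤` if there is no such chain (for instance
if `B` is empty). -/
noncomputable def skinnyDist (A B : Set (ℝ × ℝ)) : ℕ∞ :=
  ⨅ (c : List (ℤ × ℤ)) (_ : Q.IsChainJoining A B c), ((c.length - 1 : ℕ) : ℕ∞)

/-- A smaller set is at least as far away. -/
theorem skinnyDist_anti {A A' B : Set (ℝ × ℝ)} (h : A ⊆ A') :
    Q.skinnyDist A' B ≤ Q.skinnyDist A B := by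
  refine le_iInf₂ fun c hc => iInf₂_le c ?_
  obtain ⟨h1, h2, ⟨t, ht, hA⟩, h4⟩ := hc
  exact ⟨h1, h2, ⟨t, ht, hA.mono (inter_subset_inter_right _ h)⟩, h4⟩

end Quadrilateral

/-- The tiles of the rectangle `[x, x + w] × [y, y + h]`. -/
noncomputable def rectangle (x y : ℤ) (w h : ℕ) : Finset (ℤ × ℤ) :=
  Finset.Ico x (x + w) ×ˢ Finset.Ico y (y + h)

/-- A dumbbell.  The bar is the rectangle
`[barX, barX + barWidth] × [barY, barY + barHeight]`. -/
structure Dumbbell extends Quadrilateral where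
  leftBall : Finset (ℤ × ℤ)
  rightBall : Finset (ℤ × ℤ)
  barX : ℤ
  barY : ℤ
  barWidth : ℕ
  barHeight : ℕ
  /-- The bar is not empty. -/
  barHeight_pos : 0 < barHeight
  /-- The bar is at least six times as wide as high. -/
  six_mul_le : 6 * barHeight ≤ barWidth
  /-- The quadrilateral consists of the left ball, the bar and the right ball. -/
  tiles_eq : tiles = leftBall ∪
    rectangle barX barY barWidth barHeight ∪ rightBall
  balls_disjoint : Disjoint leftBall rightBall
  /-- The left ball meets the bar in a subset of the left side of the bar, ... -/
  left_inter_subset : region leftBall ∩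
      region (rectangle barX barY barWidth barHeight) ⊆
    {(barX : ℝ)} ×ˢ Icc (barY : ℝ) (barY + barHeight)
  /-- ... and this subset is connected (in particular not empty), unless there is no left ball. -/
  left_inter_connected : leftBall.Nonempty → IsConnected (region leftBall ∩
    region (rectangle barX barY barWidth barHeight))
  /-- Likewise on the right. -/
  right_inter_subset : region rightBall ∩
      region (rectangle barX barY barWidth barHeight) ⊆
    {(barX + barWidth : ℝ)} ×ˢ Icc (barY : ℝ) (barY + barHeight)
  right_inter_connected : rightBall.Nonempty → IsConnected (region rightBall ∩
    region (rectangle barX barY barWidth barHeight))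
  /-- The top of the bar lies in the top edge of the quadrilateral. -/
  top_subset :
    Icc (barX : ℝ) (barX + barWidth) ×ˢ {(barY + barHeight : ℝ)} ⊆ toQuadrilateral.topEdge
  /-- The bottom of the bar lies in the bottom edge of the quadrilateral. -/
  bottom_subset :
    Icc (barX : ℝ) (barX + barWidth) ×ˢ {(barY : ℝ)} ⊆ toQuadrilateral.bottomEdge
  /-- The left edge of the quadrilateral is at the left end.  (Together with `top_subset` this
  also says that the order of the four distinguished points is clockwise.) -/
  leftEdge_subset : toQuadrilateral.leftEdge ⊆
    region leftBall ∪ {(barX : ℝ)} ×ˢ Icc (barY : ℝ) (barY + barHeight)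
  /-- The right edge of the quadrilateral is at the right end. -/
  rightEdge_subset : toQuadrilateral.rightEdge ⊆
    region rightBall ∪ {(barX + barWidth : ℝ)} ×ˢ Icc (barY : ℝ) (barY + barHeight)
  /-- If there is no left ball, then the left edge is the left side of the bar. -/
  leftEdge_of_empty : leftBall = ∅ →
    toQuadrilateral.leftEdge = {(barX : ℝ)} ×ˢ Icc (barY : ℝ) (barY + barHeight)
  /-- If there is no right ball, then the right edge is the right side of the bar. -/
  rightEdge_of_empty : rightBall = ∅ →
    toQuadrilateral.rightEdge = {(barX + barWidth : ℝ)} ×ˢ Icc (barY : ℝ) (barY + barHeight)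

namespace Dumbbell

variable (D : Dumbbell)

/-- The tiles of the bar. -/
noncomputable def bar : Finset (ℤ × ℤ) := rectangle D.barX D.barY D.barWidth D.barHeight

/-- The part of the plane covered by the two balls. -/
def balls : Set (ℝ × ℝ) := region D.leftBall ∪ region D.rightBall

/-- A weight function `ρ` is virtually bar uniform if `ρ t = H_ρ / n`, `n` the bar height, for
every tile `t` of the bar whose skinny path distance to the balls is at least `3 n`.

The distance is taken from the interior of `t`, that is, over the chains of tiles whose first
tile is `t` itself.  By `skinnyDist_anti` this distance is at least the one from the closed tile
`t` (whose chains may also start at a neighbour of `t`), so that the property defined here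
implies the one with the distance from the closed tile. -/
def IsVirtuallyBarUniform (ρ : D.tiles → ℝ) : Prop :=
  ∀ t : D.tiles, t.1 ∈ D.bar →
    ((3 * D.barHeight : ℕ) : ℕ∞) ≤ D.skinnyDist (interior (tile t)) D.balls →
    ρ t = D.height ρ / D.barHeight

end Dumbbell

end SquareTiling

/-! An optimal weight `ρ` of height `H` is modified inside the bar without lowering the height or
raising the area. Strict convexity of the area makes the optimum unique (`eq_of_area_le`), so the
modified weight is `ρ` itself, and far from the balls it is visibly `H / n`. The modification acts
on potentials. The `potential` of a tile is the least weight of a path from the bottom edge to its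
center, capped at `H`; entering a tile raises it by at most the weight of the tile. Conversely,
`drop` gives the least weight compatible with a given potential. In the bar the potential is
confined between two ramps of slope `H / n` whose offsets are opposite. Near a ball the offset is at
least `n` and nothing changes; it decreases by one per column until it vanishes, and there the ramps
coincide and force the weight `H / n`. The area does not grow because the energy `∑ drop ^ 2` of a
column is submodular under `min` and `max`: a ramp has energy at most `H ^ 2 / n`, the minimum for a
rise of `H`, and the discarded half of each min-max pair still rises by `H`
(`sum_drop_confine_sq_le`). The height does not shrink because the new potential still rises by at
most the new weight along every path (`le_sum_newWeight`). Planar topology enters to show that near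
the middle of the bar the top and bottom edges are just the sides of the bar. -/

namespace SquareTiling

/-! ### Topology: the edges consist of boundary points of the disk -/

theorem false_of_circle_nullhomotopic {F : ℝ × ℝ → ℂ} (hF : Continuous F) (h0 : ∀ p, F p ≠ 0)
    {c : ℂ} (hc : ∀ θ, F (1, θ) = c) {ε : ℂ} (hε : ∀ θ : ℝ, F (0, θ) = ε * Complex.exp (θ * Complex.I))
    (hper : ∀ s θ, F (s, θ + 2 * Real.pi) = F (s, θ)) : False := by
  obtain ⟨G, ⟨-, hG⟩, -⟩ := Complex.isCoveringMapOn_exp.existsUnique_continuousMap_lifts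
    (⟨F, hF⟩ : C(ℝ × ℝ, ℂ)) (a₀ := (0, 0)) (e₀ := Complex.log (F (0, 0)))
    (by simpa using Complex.exp_log (h0 (0, 0))) (fun a => by simpa using h0 a)
  have hG' : ∀ p, Complex.exp (G p) = F p := fun p => congrFun hG p
  -- A continuous function with constant exponential on a connected space is constant. For the
  -- logarithm `G` of `F` this applies to the end `s = 1`, to `G - iθ` at `s = 0`, and to the
  -- increment of `G` over a period; together they give `2πi = 0`.
  have key : ∀ {A : Type} [TopologicalSpace A] [PreconnectedSpace A] (f : A → ℂ), Continuous f →
      (∀ a b, Complex.exp (f a) = Complex.exp (f b)) → ∀ a b, f a = f b := by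
    intro A _ _ f hf h a b
    exact Complex.isCoveringMap_exp.const_of_comp hf (fun a b => Subtype.ext (h a b)) a b
  have h1 := key (fun θ : ℝ => G (1, θ)) (by fun_prop) (fun a b => by simp [hG', hc])
  have h2 := key (fun θ : ℝ => G (0, θ) - θ * Complex.I) (by fun_prop) (fun a b => by
    simp only [Complex.exp_sub, hG', hε]
    rw [mul_div_assoc, mul_div_assoc, div_self (Complex.exp_ne_zero _),
      div_self (Complex.exp_ne_zero _)])
  have h3 := key (fun p : ℝ × ℝ => G (p.1, p.2 + 2 * Real.pi) - G (p.1, p.2)) (by fun_prop)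
    (fun a b => by
      simp only [Complex.exp_sub, hG', hper]
      rw [div_self (h0 _), div_self (h0 _)])
  have e1 := h1 (0 + 2 * Real.pi) 0
  have e2 := h2 (0 + 2 * Real.pi) 0
  have e3 := h3 (0, 0) (1, 0)
  simp only at e1 e2 e3
  rw [e1, sub_self] at e3
  rw [sub_eq_zero.1 e3] at e2
  have : ((2 * Real.pi : ℝ) : ℂ) * Complex.I = 0 := by
    simpa using sub_right_inj.1 e2
  simp [Real.pi_ne_zero] at this

/-- An embedding of the square into the plane maps boundary points of the square to boundary
points of its image. -/
theorem notMem_interior_image_unitSquare {g : ℝ × ℝ → ℝ × ℝ} (hg : ContinuousOn g unitSquare)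
    (hinj : InjOn g unitSquare) {b : ℝ × ℝ} (hb : b ∈ unitSquare)
    (hb' : b.1 = 0 ∨ b.1 = 1 ∨ b.2 = 0 ∨ b.2 = 1) : g b ∉ interior (g '' unitSquare) := by
  intro hint
  obtain ⟨ε, hε, hball⟩ := Metric.isOpen_iff.1 isOpen_interior _ hint
  have hcpt : CompactSpace unitSquare :=
    isCompact_iff_compactSpace.1 (isCompact_Icc.prod isCompact_Icc)
  have hemb : Topology.IsClosedEmbedding (unitSquare.domRestrict g) :=
    hg.domRestrict.isClosedEmbedding hinj.injective
  -- A small circle around `g b` lies in the image; compactness makes the inverse of `g` continuous,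
  -- so the circle pulls back to a loop `k` in the square that avoids `b`.
  set circ : ℝ → ℝ × ℝ := fun θ => ((g b).1 + ε / 2 * Real.cos θ, (g b).2 + ε / 2 * Real.sin θ)
  have hcirc : Continuous circ := by fun_prop
  have hmem : ∀ θ, circ θ ∈ g '' unitSquare := by
    intro θ
    refine interior_subset (hball ?_)
    rw [Metric.mem_ball, Prod.dist_eq, max_lt_iff]
    simp only [circ, Real.dist_eq, add_sub_cancel_left, abs_mul, abs_of_pos (half_pos hε)]
    have := Real.abs_cos_le_one θ
    have := Real.abs_sin_le_one θ
    constructor <;> nlinarith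
  choose k hk hgk using hmem
  have hkc : Continuous k := by
    have : Continuous (fun θ => (⟨k θ, hk θ⟩ : unitSquare)) := by
      rw [hemb.isInducing.continuous_iff]
      have : unitSquare.domRestrict g ∘ (fun θ => (⟨k θ, hk θ⟩ : unitSquare)) = circ := by
        funext θ; exact hgk θ
      rwa [this]
    exact continuous_subtype_val.comp this
  have hkb : ∀ θ, k θ ≠ b := by
    intro θ h
    have h1 := hgk θ
    rw [h] at h1
    have h2 := congrArg Prod.fst h1
    have h3 := congrArg Prod.snd h1
    simp only [circ] at h2 h3
    have h4 : Real.cos θ = 0 := by nlinarith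
    have h5 : Real.sin θ = 0 := by nlinarith
    have := Real.sin_sq_add_cos_sq θ
    simp [h4, h5] at this
  have hkper : ∀ θ, k (θ + 2 * Real.pi) = k θ := fun θ => hinj (hk _) (hk _) (by
    rw [hgk, hgk]; simp [circ])
  set σ : ℝ → ℝ := fun s => (projIcc (0 : ℝ) 1 zero_le_one s : ℝ)
  have hσ : Continuous σ := continuous_subtype_val.comp continuous_projIcc
  have hσm : ∀ s, 0 ≤ σ s ∧ σ s ≤ 1 := fun s => (projIcc (0 : ℝ) 1 zero_le_one s).2
  -- The straight contraction to the center avoids `b`: for positive `σ` every coordinate lies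
  -- strictly between 0 and 1, while `b` is on the boundary. The clamp `σ` makes it defined for all
  -- real `s`.
  set m : ℝ × ℝ → ℝ × ℝ := fun p =>
    ((1 - σ p.1) * (k p.2).1 + σ p.1 * (1 / 2), (1 - σ p.1) * (k p.2).2 + σ p.1 * (1 / 2))
  have hm : Continuous m := by fun_prop
  have hmmem : ∀ p, m p ∈ unitSquare := by
    rintro ⟨s, θ⟩
    obtain ⟨⟨h1, h2⟩, h3, h4⟩ := hk θ
    obtain ⟨h5, h6⟩ := hσm s
    simp only [m, unitSquare, mem_prod, mem_Icc]
    refine ⟨⟨?_, ?_⟩, ?_, ?_⟩ <;> nlinarith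
  have hmb : ∀ p, m p ≠ b := by
    rintro ⟨s, θ⟩ h
    obtain ⟨⟨h1, h2⟩, h3, h4⟩ := hk θ
    obtain ⟨h5, h6⟩ := hσm s
    rcases h5.eq_or_lt with h7 | h7
    · apply hkb θ
      rw [← h]
      ext <;> simp [m, ← h7]
    · have e1 := congrArg Prod.fst h
      have e2 := congrArg Prod.snd h
      simp only [m] at e1 e2
      rcases hb' with hb' | hb' | hb' | hb' <;>
        first
          | rw [hb'] at e1; nlinarith
          | rw [hb'] at e2; nlinarith
  set e : ℝ × ℝ → ℂ := fun p => (p.1 : ℂ) + p.2 * Complex.I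
  have he : Continuous e := by fun_prop
  have heinj : ∀ p q, e p = e q → p = q := by
    intro p q h
    have h1 := congrArg Complex.re h
    have h2 := congrArg Complex.im h
    simp [e] at h1 h2
    exact Prod.ext h1 h2
  refine false_of_circle_nullhomotopic (F := fun p => e (g (m p)) - e (g b))
    (c := e (g (1 / 2, 1 / 2)) - e (g b)) (ε := ((ε / 2 : ℝ) : ℂ)) ?_ ?_ ?_ ?_ ?_
  · exact (he.comp (hg.comp_continuous hm hmmem)).sub continuous_const
  · intro p h
    exact hmb p (hinj (hmmem p) hb (heinj _ _ (sub_eq_zero.1 h)))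
  · intro θ
    have : m (1, θ) = (1 / 2, 1 / 2) := by simp [m, σ]
    simp only [this]
  · intro θ
    have : m (0, θ) = k θ := by simp [m, σ]
    simp only [this, hgk, Complex.exp_mul_I, e, circ]
    push_cast
    ring
  · intro s θ
    simp only [m, hkper]

end SquareTiling

/-! ### Potentials on columns, their energy, and confinement between ramps -/

namespace SquareTiling

/-- The tile below `t`, and those of the other tiles having a side in common with `t` that lie
in `R`. -/
def neighbors (R : Finset (ℤ × ℤ)) (t : ℤ × ℤ) : Finset (ℤ × ℤ) :=
  insert (t.1, t.2 - 1)
    (({(t.1 - 1, t.2), (t.1 + 1, t.2), (t.1, t.2 + 1)} : Finset (ℤ × ℤ)).filter (· ∈ R))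

theorem neighbors_nonempty (R : Finset (ℤ × ℤ)) (t : ℤ × ℤ) : (neighbors R t).Nonempty :=
  Finset.insert_nonempty _ _

/-- The smallest nonnegative weight of the tile `t` for which the potential `f` increases by at
most this weight on entering `t` from a neighbor. -/
noncomputable def drop (R : Finset (ℤ × ℤ)) (f : ℤ × ℤ → ℝ) (t : ℤ × ℤ) : ℝ :=
  max 0 (f t - (neighbors R t).inf' (neighbors_nonempty R t) f)

variable {R : Finset (ℤ × ℤ)} {f g : ℤ × ℤ → ℝ} {t s : ℤ × ℤ}

theorem drop_nonneg : 0 ≤ drop R f t := le_max_left _ _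

theorem le_add_drop (hs : s ∈ neighbors R t) : f t ≤ f s + drop R f t := by
  have h1 := Finset.inf'_le f hs
  have h2 := le_max_right 0 (f t - (neighbors R t).inf' (neighbors_nonempty R t) f)
  rw [drop]
  linarith

theorem drop_le {w : ℝ} (hw : 0 ≤ w) (h : ∀ s ∈ neighbors R t, f t ≤ f s + w) :
    drop R f t ≤ w := by
  refine max_le hw ?_
  obtain ⟨s, hs, he⟩ := Finset.exists_mem_eq_inf' (neighbors_nonempty R t) f
  rw [he]
  linarith [h s hs]

/-- Membership holds even below `R`; this is how the value zero under the bar acts as a boundary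
condition. -/
theorem below_mem_neighbors (R : Finset (ℤ × ℤ)) (x y : ℤ) : (x, y - 1) ∈ neighbors R (x, y) :=
  Finset.mem_insert_self _ _

/-- If the two pairs are oppositely ordered, the differences on the left have the same sum as those
on the right and lie between them, so convexity of the squared positive part applies. -/
theorem sq_posPart_min_add_max_le (x y p q : ℝ) :
    max 0 (min x y - min p q) ^ 2 + max 0 (max x y - max p q) ^ 2 ≤
      max 0 (x - p) ^ 2 + max 0 (y - q) ^ 2 := by
  wlog hxy : x ≤ y generalizing x y p q
  · have := this y x q p (le_of_not_ge hxy)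
    rw [min_comm x, min_comm p, max_comm x, max_comm p]
    linarith
  rw [min_eq_left hxy, max_eq_right hxy]
  rcases le_total p q with h | h
  · rw [min_eq_left h, max_eq_right h]
  · rw [min_eq_right h, max_eq_left h]
    rcases max_cases 0 (x - q) with ⟨e1, h1⟩ | ⟨e1, h1⟩ <;>
    rcases max_cases 0 (y - p) with ⟨e2, h2⟩ | ⟨e2, h2⟩ <;>
    rcases max_cases 0 (x - p) with ⟨e3, h3⟩ | ⟨e3, h3⟩ <;>
    rcases max_cases 0 (y - q) with ⟨e4, h4⟩ | ⟨e4, h4⟩ <;>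
    rw [e1, e2, e3, e4] <;> nlinarith [mul_nonneg (sub_nonneg.2 hxy) (sub_nonneg.2 h)]

/-- Submodularity of the energy, tile by tile: the infimum of `min f g` over the neighbors is at
least the `min` of the infima, and likewise for `max`. -/
theorem drop_min_sq_add_drop_max_sq_le :
    drop R (fun t => min (f t) (g t)) t ^ 2 + drop R (fun t => max (f t) (g t)) t ^ 2 ≤
      drop R f t ^ 2 + drop R g t ^ 2 := by
  set N := neighbors_nonempty R t
  refine le_trans (add_le_add (pow_le_pow_left₀ drop_nonneg ?_ 2)
    (pow_le_pow_left₀ drop_nonneg ?_ 2)) (sq_posPart_min_add_max_le (f t) (g t)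
      ((neighbors R t).inf' N f) ((neighbors R t).inf' N g))
  · refine max_le_max le_rfl (sub_le_sub_left ?_ _)
    exact Finset.le_inf' _ _ fun s hs =>
      min_le_min (Finset.inf'_le f hs) (Finset.inf'_le g hs)
  · refine max_le_max le_rfl (sub_le_sub_left ?_ _)
    exact Finset.le_inf' _ _ fun s hs =>
      max_le_max (Finset.inf'_le f hs) (Finset.inf'_le g hs)

/-- The rise of a potential along a column is at most the sum of the drops. -/
theorem sub_le_sum_drop (x y : ℤ) (n : ℕ) :
    f (x, y + n - 1) - f (x, y - 1) ≤ ∑ j ∈ Finset.Ico y (y + n), drop R f (x, j) := by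
  induction n with
  | zero => simp
  | succ k ih =>
    have h : Finset.Ico y (y + (k + 1 : ℕ)) = insert (y + k) (Finset.Ico y (y + k)) := by
      ext z; simp only [Finset.mem_Ico, Finset.mem_insert]; push_cast; omega
    rw [h, Finset.sum_insert (by simp)]
    have h1 := le_add_drop (f := f) (below_mem_neighbors R x (y + k))
    have h2 : y + (k + 1 : ℕ) - 1 = y + k := by push_cast; ring
    rw [h2]
    linarith

/-- Cauchy–Schwarz: constant speed is the cheapest way to rise by `H` in a column of `n` tiles. -/
theorem sq_div_le_sum_drop_sq {H : ℝ} (hH : 0 ≤ H) (x y : ℤ) (n : ℕ)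
    (h : H ≤ f (x, y + n - 1) - f (x, y - 1)) :
    H ^ 2 / n ≤ ∑ j ∈ Finset.Ico y (y + n), drop R f (x, j) ^ 2 := by
  rcases Nat.eq_zero_or_pos n with rfl | hn
  · simp
  rw [div_le_iff₀ (by exact_mod_cast hn)]
  have h1 := sq_sum_le_card_mul_sum_sq (s := Finset.Ico y (y + n)) (f := fun j => drop R f (x, j))
  simp only [Int.card_Ico, add_sub_cancel_left, Int.toNat_natCast] at h1
  have h2 := pow_le_pow_left₀ hH (h.trans (sub_le_sum_drop (R := R) x y n)) 2
  linarith

/-- The potential that rises at constant speed in each column, with an offset that depends on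
the column. -/
noncomputable def ramp (H : ℝ) (y : ℤ) (n : ℕ) (o : ℤ → ℤ) (t : ℤ × ℤ) : ℝ :=
  H * (t.2 - y + 1 + o t.1) / n

/-- As the offset changes by at most one between columns, a sideways step costs no more than a step
up. -/
theorem drop_ramp_le {H : ℝ} (hH : 0 ≤ H) {y : ℤ} {n : ℕ} {o : ℤ → ℤ}
    (ho : ∀ x, |o (x + 1) - o x| ≤ 1) : drop R (ramp H y n o) t ≤ H / n := by
  refine drop_le (by positivity) fun s hs => ?_
  have key : t.2 + o t.1 ≤ s.2 + o s.1 + 1 := by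
    have h1 := abs_le.1 (ho t.1)
    have h2 := abs_le.1 (ho (t.1 - 1))
    rw [sub_add_cancel] at h2
    simp only [neighbors, Finset.mem_insert, Finset.mem_filter, Finset.mem_singleton] at hs
    rcases hs with rfl | ⟨rfl | rfl | rfl, -⟩ <;> simp only <;> omega
  have key' : (t.2 : ℝ) + o t.1 ≤ s.2 + o s.1 + 1 := by exact_mod_cast key
  rw [ramp, ramp, ← add_div]
  gcongr
  nlinarith

theorem sum_drop_ramp_sq_le {H : ℝ} (hH : 0 ≤ H) (x y : ℤ) (n : ℕ) {o : ℤ → ℤ}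
    (ho : ∀ x, |o (x + 1) - o x| ≤ 1) :
    ∑ j ∈ Finset.Ico y (y + n), drop R (ramp H y n o) (x, j) ^ 2 ≤ H ^ 2 / n := by
  rcases Nat.eq_zero_or_pos n with rfl | hn
  · simp
  have h1 : ∑ j ∈ Finset.Ico y (y + n), drop R (ramp H y n o) (x, j) ^ 2 ≤
      ∑ j ∈ Finset.Ico y (y + n), (H / n) ^ 2 :=
    Finset.sum_le_sum fun j _ => pow_le_pow_left₀ drop_nonneg (drop_ramp_le hH ho) 2
  refine h1.trans_eq ?_
  have : (n : ℝ) ≠ 0 := by positivity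
  simp
  field_simp

/-- The potential `f`, confined between two ramps with opposite offsets. -/
noncomputable def confine (H : ℝ) (y : ℤ) (n : ℕ) (o : ℤ → ℤ) (f : ℤ × ℤ → ℝ) (t : ℤ × ℤ) : ℝ :=
  max (min (f t) (ramp H y n o t)) (ramp H y n (-o) t)

/-- Confining a potential between ramps does not increase the energy of a column. -/
theorem sum_drop_confine_sq_le {H : ℝ} (hH : 0 ≤ H) (x y : ℤ) {n : ℕ} (hn : 0 < n) {o : ℤ → ℤ}
    (ho : ∀ x, |o (x + 1) - o x| ≤ 1) (ho0 : 0 ≤ o x) (hbot : f (x, y - 1) = 0)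
    (htop : f (x, y + n - 1) = H) :
    ∑ j ∈ Finset.Ico y (y + n), drop R (confine H y n o f) (x, j) ^ 2 ≤
      ∑ j ∈ Finset.Ico y (y + n), drop R f (x, j) ^ 2 := by
  have hn' : (0 : ℝ) < n := by exact_mod_cast hn
  have ho0' : (0 : ℝ) ≤ o x := by exact_mod_cast ho0
  have ho' : ∀ x, |(-o) (x + 1) - (-o) x| ≤ 1 := fun x => by
    rw [abs_sub_comm]
    simpa [add_comm, sub_eq_add_neg] using ho x
  have hd : 0 ≤ H * o x / n := by positivity
  have r1 : ramp H y n o (x, y + n - 1) = H + H * o x / n := by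
    simp only [ramp]; push_cast; field_simp; ring
  have r2 : ramp H y n o (x, y - 1) = H * o x / n := by
    simp only [ramp]; push_cast; field_simp; ring
  have r3 : ramp H y n (-o) (x, y + n - 1) = H - H * o x / n := by
    simp only [ramp, Pi.neg_apply]; push_cast; field_simp; ring
  have r4 : ramp H y n (-o) (x, y - 1) = - (H * o x / n) := by
    simp only [ramp, Pi.neg_apply]; push_cast; field_simp; ring
  set f₁ : ℤ × ℤ → ℝ := fun t => min (f t) (ramp H y n o t)
  have s1 : ∑ j ∈ Finset.Ico y (y + n), drop R f₁ (x, j) ^ 2 ≤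
      ∑ j ∈ Finset.Ico y (y + n), drop R f (x, j) ^ 2 := by
    have h1 := Finset.sum_le_sum fun j (_ : j ∈ Finset.Ico y (y + n)) =>
      drop_min_sq_add_drop_max_sq_le (R := R) (f := f) (g := ramp H y n o) (t := (x, j))
    rw [Finset.sum_add_distrib, Finset.sum_add_distrib] at h1
    have h2 := sum_drop_ramp_sq_le (R := R) hH x y n ho
    -- The maximum goes from `H * o x / n` at the bottom to `H + H * o x / n` at the top, a rise of
    -- `H`. Its energy thus cancels that of the ramp.
    have h3 := sq_div_le_sum_drop_sq (R := R) (f := fun t => max (f t) (ramp H y n o t)) hH x y n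
      (by simp only [r1, r2, hbot, htop]
          rw [max_eq_right hd, max_eq_right (by linarith)]; linarith)
    linarith
  refine le_trans ?_ s1
  have h1 := Finset.sum_le_sum fun j (_ : j ∈ Finset.Ico y (y + n)) =>
    drop_min_sq_add_drop_max_sq_le (R := R) (f := f₁) (g := ramp H y n (-o)) (t := (x, j))
  rw [Finset.sum_add_distrib, Finset.sum_add_distrib] at h1
  have h2 := sum_drop_ramp_sq_le (R := R) hH x y n ho'
  -- Dually, the discarded minimum goes from `-(H * o x / n)` to `H - H * o x / n`.
  have h3 := sq_div_le_sum_drop_sq (R := R) (f := fun t => min (f₁ t) (ramp H y n (-o) t)) hH x y n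
    (by simp only [f₁, r1, r2, r3, r4, hbot, htop]
        rw [min_eq_left hd, min_eq_left (by linarith : H ≤ H + _), min_eq_right (by linarith),
          min_eq_right (by linarith)]; linarith)
  have h4 : ∀ j, drop R (confine H y n o f) (x, j) =
      drop R (fun t => max (f₁ t) (ramp H y n (-o) t)) (x, j) := fun j => rfl
  simp only [h4]
  linarith

end SquareTiling

/-! ### Tiles, stars of points, and adjacency -/

namespace SquareTiling

theorem mem_tile {t : ℤ × ℤ} {v : ℝ × ℝ} :
    v ∈ tile t ↔ ((t.1 : ℝ) ≤ v.1 ∧ v.1 ≤ t.1 + 1) ∧ (t.2 : ℝ) ≤ v.2 ∧ v.2 ≤ t.2 + 1 := by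
  rw [tile, mem_prod, mem_Icc, mem_Icc]

theorem isClosed_tile (t : ℤ × ℤ) : IsClosed (tile t) := isClosed_Icc.prod isClosed_Icc

theorem mem_region {S : Finset (ℤ × ℤ)} {v : ℝ × ℝ} : v ∈ region S ↔ ∃ t ∈ S, v ∈ tile t := by
  simp [region]

theorem isClosed_region (S : Finset (ℤ × ℤ)) : IsClosed (region S) :=
  isClosed_biUnion_finset fun t _ => isClosed_tile t

/-- The center of a tile. -/
noncomputable def center (t : ℤ × ℤ) : ℝ × ℝ := (t.1 + 1 / 2, t.2 + 1 / 2)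

theorem eq_of_mem_tile_of_lt {t u : ℤ × ℤ} {v : ℝ × ℝ} (h1 : (t.1 : ℝ) < v.1) (h2 : v.1 < t.1 + 1)
    (h3 : (t.2 : ℝ) < v.2) (h4 : v.2 < t.2 + 1) (hu : v ∈ tile u) : u = t := by
  rw [mem_tile] at hu
  obtain ⟨⟨h5, h6⟩, h7, h8⟩ := hu
  have a1 : (u.1 : ℝ) < t.1 + 1 := by linarith
  have a2 : (t.1 : ℝ) < u.1 + 1 := by linarith
  have a3 : (u.2 : ℝ) < t.2 + 1 := by linarith
  have a4 : (t.2 : ℝ) < u.2 + 1 := by linarith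
  norm_cast at a1 a2 a3 a4
  ext <;> omega

theorem sub_le_one_of_mem_tile {s t : ℤ × ℤ} {v : ℝ × ℝ} (hs : v ∈ tile s) (ht : v ∈ tile t) :
    s.1 ≤ t.1 + 1 ∧ t.1 ≤ s.1 + 1 ∧ s.2 ≤ t.2 + 1 ∧ t.2 ≤ s.2 + 1 := by
  rw [mem_tile] at hs ht
  obtain ⟨⟨h1, h2⟩, h3, h4⟩ := hs
  obtain ⟨⟨h5, h6⟩, h7, h8⟩ := ht
  refine ⟨?_, ?_, ?_, ?_⟩
  · exact_mod_cast (by linarith : (s.1 : ℝ) ≤ t.1 + 1)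
  · exact_mod_cast (by linarith : (t.1 : ℝ) ≤ s.1 + 1)
  · exact_mod_cast (by linarith : (s.2 : ℝ) ≤ t.2 + 1)
  · exact_mod_cast (by linarith : (t.2 : ℝ) ≤ s.2 + 1)

open Classical in
/-- The tiles of `T` that contain the point `v`. -/
noncomputable def star (T : Finset (ℤ × ℤ)) (v : ℝ × ℝ) : Finset (ℤ × ℤ) :=
  T.filter fun t => v ∈ tile t

variable {T S S' A : Finset (ℤ × ℤ)} {s t : ℤ × ℤ} {v : ℝ × ℝ}

theorem mem_star : t ∈ star T v ↔ t ∈ T ∧ v ∈ tile t := by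
  classical
  simp [star]

/-- The points of `region T` that lie in no tile of `T` outside `S`. -/
def within (T S : Finset (ℤ × ℤ)) : Set (ℝ × ℝ) := {v | v ∈ region T ∧ star T v ⊆ S}

theorem within_mono (h : S ⊆ S') : within T S ⊆ within T S' := fun _ hv => ⟨hv.1, hv.2.trans h⟩

/-- Past `v`, the segment to the center runs in the interior of `t` and so meets no other tile. -/
theorem joinedIn_center (ht : t ∈ T) (hv : v ∈ tile t) :
    JoinedIn (within T (star T v)) v (center t) := by
  have hvt : t ∈ star T v := mem_star.2 ⟨ht, hv⟩
  apply JoinedIn.of_segment_subset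
  rintro _ ⟨a, b, ha, hb, hab, rfl⟩
  obtain ⟨⟨h1, h2⟩, h3, h4⟩ := mem_tile.1 hv
  rcases hb.eq_or_lt with rfl | hb
  · have : a = 1 := by linarith
    subst this
    rw [one_smul, zero_smul, add_zero]
    exact ⟨mem_region.2 ⟨t, ht, hv⟩, Finset.Subset.refl _⟩
  · have ha1 : a = 1 - b := by linarith
    subst ha1
    have e1 : (t.1 : ℝ) < ((1 - b) • v + b • center t).1 := by
      simp [center]; nlinarith
    have e2 : ((1 - b) • v + b • center t).1 < t.1 + 1 := by
      simp [center]; nlinarith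
    have e3 : (t.2 : ℝ) < ((1 - b) • v + b • center t).2 := by
      simp [center]; nlinarith
    have e4 : ((1 - b) • v + b • center t).2 < t.2 + 1 := by
      simp [center]; nlinarith
    refine ⟨mem_region.2 ⟨t, ht, mem_tile.2 ⟨⟨e1.le, e2.le⟩, e3.le, e4.le⟩⟩, fun u hu => ?_⟩
    rw [eq_of_mem_tile_of_lt e1 e2 e3 e4 (mem_star.1 hu).2]
    exact hvt

/-- Two tiles of `T` are adjacent if they share a point that lies in no other tile of `T`. -/
def Adjacent (T : Finset (ℤ × ℤ)) (s t : ℤ × ℤ) : Prop :=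
  s ∈ T ∧ t ∈ T ∧ ∃ v, v ∈ tile s ∧ v ∈ tile t ∧ star T v ⊆ {s, t}

theorem Adjacent.symm (h : Adjacent T s t) : Adjacent T t s := by
  obtain ⟨h1, h2, v, h3, h4, h5⟩ := h
  exact ⟨h2, h1, v, h4, h3, by rwa [Finset.pair_comm]⟩

theorem Adjacent.joinedIn (h : Adjacent T s t) :
    JoinedIn (within T {s, t}) (center s) (center t) := by
  obtain ⟨h1, h2, v, h3, h4, h5⟩ := h
  exact ((joinedIn_center h1 h3).symm.trans (joinedIn_center h2 h4)).mono (within_mono h5)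

/-- The midpoint of the common side lies in no third tile. -/
theorem adjacent_of_fst_eq (hs : s ∈ T) (ht : t ∈ T) (h1 : s.1 = t.1) (h2 : t.2 = s.2 + 1) :
    Adjacent T s t := by
  have h1' : (s.1 : ℝ) = t.1 := by exact_mod_cast h1
  have h2' : (t.2 : ℝ) = s.2 + 1 := by exact_mod_cast h2
  refine ⟨hs, ht, (t.1 + 1 / 2, t.2), ?_, ?_, fun u hu => ?_⟩
  · rw [mem_tile]; simp only; refine ⟨⟨?_, ?_⟩, ?_, ?_⟩ <;> linarith
  · rw [mem_tile]; simp only; refine ⟨⟨?_, ?_⟩, ?_, ?_⟩ <;> linarith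
  · obtain ⟨⟨h5, h6⟩, h7, h8⟩ := mem_tile.1 (mem_star.1 hu).2
    simp only at h5 h6 h7 h8
    have a1 : (u.1 : ℝ) < t.1 + 1 := by linarith
    have a2 : (t.1 : ℝ) < u.1 + 1 := by linarith
    norm_cast at a1 a2 h7 h8
    rw [Finset.mem_insert, Finset.mem_singleton]
    rcases (by omega : u.2 = s.2 ∨ u.2 = t.2) with h | h
    · exact Or.inl (Prod.ext (by omega) h)
    · exact Or.inr (Prod.ext (by omega) h)

theorem adjacent_of_snd_eq (hs : s ∈ T) (ht : t ∈ T) (h1 : s.2 = t.2) (h2 : t.1 = s.1 + 1) :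
    Adjacent T s t := by
  have h1' : (s.2 : ℝ) = t.2 := by exact_mod_cast h1
  have h2' : (t.1 : ℝ) = s.1 + 1 := by exact_mod_cast h2
  refine ⟨hs, ht, (t.1, t.2 + 1 / 2), ?_, ?_, fun u hu => ?_⟩
  · rw [mem_tile]; simp only; refine ⟨⟨?_, ?_⟩, ?_, ?_⟩ <;> linarith
  · rw [mem_tile]; simp only; refine ⟨⟨?_, ?_⟩, ?_, ?_⟩ <;> linarith
  · obtain ⟨⟨h5, h6⟩, h7, h8⟩ := mem_tile.1 (mem_star.1 hu).2
    simp only at h5 h6 h7 h8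
    have a1 : (u.2 : ℝ) < t.2 + 1 := by linarith
    have a2 : (t.2 : ℝ) < u.2 + 1 := by linarith
    norm_cast at a1 a2 h5 h6
    rw [Finset.mem_insert, Finset.mem_singleton]
    rcases (by omega : u.1 = s.1 ∨ u.1 = t.1) with h | h
    · exact Or.inl (Prod.ext h (by omega))
    · exact Or.inr (Prod.ext h (by omega))

/-- Two tiles whose positions differ by one in exactly one coordinate are adjacent. -/
theorem adjacent_of_side (hs : s ∈ T) (ht : t ∈ T)
    (h : s.1 = t.1 ∧ (t.2 = s.2 + 1 ∨ s.2 = t.2 + 1) ∨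
      s.2 = t.2 ∧ (t.1 = s.1 + 1 ∨ s.1 = t.1 + 1)) : Adjacent T s t := by
  rcases h with ⟨h, h' | h'⟩ | ⟨h, h' | h'⟩
  · exact adjacent_of_fst_eq hs ht h h'
  · exact (adjacent_of_fst_eq ht hs h.symm h').symm
  · exact adjacent_of_snd_eq hs ht h h'
  · exact (adjacent_of_snd_eq ht hs h.symm h').symm

/-- A point common to two diagonal tiles lies in all four tiles around it. -/
theorem mem_tile_of_diagonal (hs : v ∈ tile s) (ht : v ∈ tile t) : v ∈ tile (s.1, t.2) := by
  rw [mem_tile] at *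
  exact ⟨hs.1, ht.2⟩

/-- The star of a point is connected with respect to adjacency. -/
theorem exists_adjacent_of_mem_star (hs : s ∈ star T v) (ht : t ∈ star T v) (hsA : s ∈ A)
    (htA : t ∉ A) : ∃ s' ∈ star T v, ∃ t' ∈ star T v, s' ∈ A ∧ t' ∉ A ∧ Adjacent T s' t' := by
  obtain ⟨hsT, hsv⟩ := mem_star.1 hs
  obtain ⟨htT, htv⟩ := mem_star.1 ht
  obtain ⟨b1, b2, b3, b4⟩ := sub_le_one_of_mem_tile hsv htv
  have hne : s ≠ t := fun h => htA (h ▸ hsA)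
  by_cases h1 : s.1 = t.1
  · have : s.2 ≠ t.2 := fun h => hne (Prod.ext h1 h)
    exact ⟨s, hs, t, ht, hsA, htA, adjacent_of_side hsT htT (Or.inl ⟨h1, by omega⟩)⟩
  by_cases h2 : s.2 = t.2
  · exact ⟨s, hs, t, ht, hsA, htA, adjacent_of_side hsT htT (Or.inr ⟨h2, by omega⟩)⟩
  -- For diagonal `s` and `t`, a tile of `T` at one of the other two corners around `v` has a side
  -- in common with both, so the crossing out of `A` occurs at one of these sides.
  have corner : ∀ u, u ∈ star T v → (u.1 = s.1 ∧ u.2 = t.2 ∨ u.1 = t.1 ∧ u.2 = s.2) →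
      ∃ s' ∈ star T v, ∃ t' ∈ star T v, s' ∈ A ∧ t' ∉ A ∧ Adjacent T s' t' := by
    intro u hu h
    have huT := (mem_star.1 hu).1
    by_cases huA : u ∈ A
    · exact ⟨u, hu, t, ht, huA, htA, adjacent_of_side huT htT (by omega)⟩
    · exact ⟨s, hs, u, hu, hsA, huA, adjacent_of_side hsT huT (by omega)⟩
  by_cases h3 : (s.1, t.2) ∈ T
  · exact corner _ (mem_star.2 ⟨h3, mem_tile_of_diagonal hsv htv⟩) (Or.inl ⟨rfl, rfl⟩)
  by_cases h4 : (t.1, s.2) ∈ T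
  · exact corner _ (mem_star.2 ⟨h4, mem_tile_of_diagonal htv hsv⟩) (Or.inr ⟨rfl, rfl⟩)
  -- Neither corner tile is in `T`, so `v` itself lies in `s` and `t` only, and these are adjacent
  -- diagonally.
  refine ⟨s, hs, t, ht, hsA, htA, hsT, htT, v, hsv, htv, fun u hu => ?_⟩
  obtain ⟨huT, huv⟩ := mem_star.1 hu
  obtain ⟨c1, c2, c3, c4⟩ := sub_le_one_of_mem_tile huv htv
  obtain ⟨d1, d2, d3, d4⟩ := sub_le_one_of_mem_tile huv hsv
  rw [Finset.mem_insert, Finset.mem_singleton]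
  rcases (by omega : u.1 = s.1 ∨ u.1 = t.1) with e1 | e1 <;>
    rcases (by omega : u.2 = s.2 ∨ u.2 = t.2) with e2 | e2
  · exact Or.inl (Prod.ext e1 e2)
  · exact absurd (by rwa [← e1, ← e2]) h3
  · exact absurd (by rwa [← e1, ← e2]) h4
  · exact Or.inr (Prod.ext e1 e2)

/-- The tiles met by a connected set are connected with respect to adjacency. -/
theorem exists_adjacent_of_isPreconnected {W : Set (ℝ × ℝ)} (hW : IsPreconnected W)
    (hWT : W ⊆ region T) (hS : ∀ v ∈ W, star T v ⊆ S) (hST : ∀ t ∈ S, t ∈ T ∧ (tile t ∩ W).Nonempty)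
    (hA : A.Nonempty) (hAS : A ⊆ S) (hne : A ≠ S) :
    ∃ s ∈ A, ∃ t ∈ S, t ∉ A ∧ Adjacent T s t := by
  classical
  obtain ⟨t₀, ht₀, ht₀A⟩ : ∃ t ∈ S, t ∉ A := by
    by_contra! h
    exact hne (Finset.Subset.antisymm hAS h)
  obtain ⟨s₀, hs₀⟩ := hA
  obtain ⟨x, hx1, hx2⟩ := (hST s₀ (hAS hs₀)).2
  obtain ⟨y, hy1, hy2⟩ := (hST t₀ ht₀).2
  -- The closed sets covered by `A` and by `S \ A` cover `W`, hence share a point `v` of `W`; the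
  -- crossing is found in its star.
  obtain ⟨v, hvW, hvA, hvB⟩ := isPreconnected_closed_iff.1 hW (region A) (region (S \ A))
    (isClosed_region _) (isClosed_region _) (fun v hv => by
      obtain ⟨u, huT, huv⟩ := mem_region.1 (hWT hv)
      have huS := hS v hv (mem_star.2 ⟨huT, huv⟩)
      by_cases huA : u ∈ A
      · exact Or.inl (mem_region.2 ⟨u, huA, huv⟩)
      · exact Or.inr (mem_region.2 ⟨u, Finset.mem_sdiff.2 ⟨huS, huA⟩, huv⟩))
    ⟨x, hx2, mem_region.2 ⟨s₀, hs₀, hx1⟩⟩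
    ⟨y, hy2, mem_region.2 ⟨t₀, Finset.mem_sdiff.2 ⟨ht₀, ht₀A⟩, hy1⟩⟩
  obtain ⟨a, ha, hav⟩ := mem_region.1 hvA
  obtain ⟨b, hb, hbv⟩ := mem_region.1 hvB
  rw [Finset.mem_sdiff] at hb
  obtain ⟨s, hs, t, ht, hsA, htA, hst⟩ := exists_adjacent_of_mem_star (A := A)
    (mem_star.2 ⟨(hST a (hAS ha)).1, hav⟩) (mem_star.2 ⟨(hST b hb.1).1, hbv⟩) ha hb.2
  exact ⟨s, hsA, t, hS v hvW ht, htA, hst⟩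

/-- If a potential rises by at most `w t` on entering a tile `t`, then it is bounded by the
total weight of any connected set of tiles containing a suitable base. -/
theorem exists_potential_add_sum_le {V : Type*} [DecidableEq V] {adj : V → V → Prop}
    {w π : V → ℝ} (hw : ∀ t, 0 ≤ w t) (hadj : ∀ s t, adj s t → π t ≤ π s + w t)
    {B S X : Finset V} (hBS : B ⊆ S) (hB : ∀ t ∈ B, π t ≤ ∑ u ∈ B, w u)
    (hconn : ∀ A, B ⊆ A → A ⊆ S → A ≠ S → ∃ s ∈ A, ∃ t ∈ S, t ∉ A ∧ adj s t)
    (hXS : X ⊆ S) (hX : X.Nonempty) (hBX : Disjoint B X) :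
    ∃ t ∈ X, π t + ∑ u ∈ X.erase t, w u ≤ ∑ u ∈ S, w u := by
  -- Growth from `B` by adjacent tiles preserves the bound. A largest such `A` avoiding `X` can only
  -- be extended by a tile of `X`, the first one reached.
  obtain ⟨A, hA, hmax⟩ := (S.powerset.filter fun A => B ⊆ A ∧ Disjoint A X ∧
    ∀ t ∈ A, π t ≤ ∑ u ∈ A, w u).exists_max_image Finset.card
    ⟨B, by simp only [Finset.mem_filter, Finset.mem_powerset]
           exact ⟨hBS, Finset.Subset.refl _, hBX, hB⟩⟩
  simp only [Finset.mem_filter, Finset.mem_powerset] at hA hmax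
  obtain ⟨hAS, hBA, hAX, hAπ⟩ := hA
  have hne : A ≠ S := by
    rintro rfl
    obtain ⟨x, hx⟩ := hX
    exact Finset.disjoint_left.1 hAX (hXS hx) hx
  obtain ⟨s, hs, t, ht, htA, hst⟩ := hconn A hBA hAS hne
  have hπt : π t ≤ ∑ u ∈ insert t A, w u := by
    rw [Finset.sum_insert htA]
    linarith [hadj s t hst, hAπ s hs]
  by_cases htX : t ∈ X
  · refine ⟨t, htX, ?_⟩
    -- The rest of `X` is disjoint from `A`, so its weight can still be added.
    have h1 : ∑ u ∈ A ∪ X, w u ≤ ∑ u ∈ S, w u :=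
      Finset.sum_le_sum_of_subset_of_nonneg (Finset.union_subset hAS hXS) fun u _ _ => hw u
    rw [Finset.sum_union hAX, ← Finset.add_sum_erase X w htX] at h1
    linarith [hadj s t hst, hAπ s hs]
  · exfalso
    have h := hmax (insert t A) ⟨Finset.insert_subset ht hAS, hBA.trans (Finset.subset_insert _ _),
      Finset.disjoint_insert_left.2 ⟨htX, hAX⟩, fun u hu => by
        rcases Finset.mem_insert.1 hu with rfl | hu
        · exact hπt
        · exact (hAπ u hu).trans (Finset.sum_le_sum_of_subset_of_nonneg
            (Finset.subset_insert _ _) fun u _ _ => hw u)⟩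
    rw [Finset.card_insert_of_notMem htA] at h
    omega

end SquareTiling

/-! ### Heights, uniqueness of the optimum, and the potential of a weight -/

namespace SquareTiling

namespace Quadrilateral

variable (Q : Quadrilateral) (ρ : Q.tiles → ℝ)

/-- A weight function, extended by zero to all tiles of the plane. -/
def extend (t : ℤ × ℤ) : ℝ := if h : t ∈ Q.tiles then ρ ⟨t, h⟩ else 0

variable {Q ρ}

theorem extend_coe (t : Q.tiles) : Q.extend ρ t = ρ t := by simp [extend]

theorem extend_nonneg (hρ : ∀ t, 0 ≤ ρ t) (t : ℤ × ℤ) : 0 ≤ Q.extend ρ t := by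
  unfold extend
  split_ifs
  exacts [hρ _, le_rfl]

open Classical in
/-- The tiles of a quadrilateral that meet a given set. -/
noncomputable def meeting (Q : Quadrilateral) (W : Set (ℝ × ℝ)) : Finset (ℤ × ℤ) :=
  Q.tiles.filter fun t => (tile t ∩ W).Nonempty

theorem mem_meeting {W : Set (ℝ × ℝ)} {t : ℤ × ℤ} :
    t ∈ Q.meeting W ↔ t ∈ Q.tiles ∧ (tile t ∩ W).Nonempty := by
  classical
  simp [meeting]

theorem length_eq_sum (W : Set (ℝ × ℝ)) : Q.length ρ W = ∑ t ∈ Q.meeting W, Q.extend ρ t := by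
  classical
  rw [length, meeting, Finset.sum_filter, Finset.sum_filter, ← Finset.sum_coe_sort Q.tiles]
  exact Finset.sum_congr rfl fun t _ => by rw [extend_coe]

theorem area_eq_sum : Q.area ρ = ∑ t ∈ Q.tiles, Q.extend ρ t ^ 2 := by
  rw [area, ← Finset.sum_coe_sort Q.tiles]
  exact Finset.sum_congr rfl fun t _ => by rw [extend_coe]

theorem length_nonneg (hρ : ∀ t, 0 ≤ ρ t) (W : Set (ℝ × ℝ)) : 0 ≤ Q.length ρ W :=
  Finset.sum_nonneg fun t _ => hρ t

theorem bddBelow_lengths (hρ : ∀ t, 0 ≤ ρ t) :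
    BddBelow {l | ∃ x ∈ Q.topEdge, ∃ y ∈ Q.bottomEdge, ∃ γ : Path x y,
      range γ ⊆ Q.carrier ∧ l = Q.length ρ (range γ)} := by
  refine ⟨0, ?_⟩
  rintro _ ⟨x, -, y, -, γ, -, rfl⟩
  exact length_nonneg hρ _

/-- Ensures that the infimum defining the height is not the default value `sInf ∅ = 0`. -/
theorem exists_path (Q : Quadrilateral) : ∃ x ∈ Q.topEdge, ∃ y ∈ Q.bottomEdge, ∃ γ : Path x y,
    range γ ⊆ Q.carrier := by
  have hconv : Convex ℝ unitSquare := (convex_Icc 0 1).prod (convex_Icc 0 1)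
  have h0 : ((0 : ℝ), (0 : ℝ)) ∈ unitSquare := by simp [unitSquare]
  have h1 : ((0 : ℝ), (1 : ℝ)) ∈ unitSquare := by simp [unitSquare]
  have h := (hconv.isPathConnected ⟨_, h0⟩).image' Q.continuousOn_param
  rw [Q.image_param] at h
  obtain ⟨γ, hγ⟩ := h.joinedIn (Q.param (0, 1)) (by rw [← Q.image_param]; exact mem_image_of_mem _ h1)
    (Q.param (0, 0)) (by rw [← Q.image_param]; exact mem_image_of_mem _ h0)
  refine ⟨_, mem_image_of_mem _ (by simp), _, mem_image_of_mem _ (by simp), γ, ?_⟩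
  rintro _ ⟨s, rfl⟩
  exact hγ s

theorem le_height {H : ℝ} (h : ∀ x ∈ Q.topEdge, ∀ y ∈ Q.bottomEdge, ∀ γ : Path x y,
    range γ ⊆ Q.carrier → H ≤ Q.length ρ (range γ)) : H ≤ Q.height ρ := by
  obtain ⟨x, hx, y, hy, γ, hγ⟩ := exists_path Q
  refine le_csInf ⟨_, x, hx, y, hy, γ, hγ, rfl⟩ ?_
  rintro _ ⟨x, hx, y, hy, γ, hγ, rfl⟩
  exact h x hx y hy γ hγ

theorem height_le_length (hρ : ∀ t, 0 ≤ ρ t) {x y : ℝ × ℝ} (hx : x ∈ Q.topEdge)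
    (hy : y ∈ Q.bottomEdge) (γ : Path x y) (hγ : range γ ⊆ Q.carrier) :
    Q.height ρ ≤ Q.length ρ (range γ) :=
  csInf_le (bddBelow_lengths hρ) ⟨x, hx, y, hy, γ, hγ, rfl⟩

theorem height_nonneg (hρ : ∀ t, 0 ≤ ρ t) : 0 ≤ Q.height ρ :=
  le_height fun _ _ _ _ _ _ => length_nonneg hρ _

theorem height_add_le {σ : Q.tiles → ℝ} (hρ : ∀ t, 0 ≤ ρ t) (hσ : ∀ t, 0 ≤ σ t) :
    Q.height ρ + Q.height σ ≤ Q.height (ρ + σ) := by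
  refine le_height fun x hx y hy γ hγ => ?_
  have : Q.length (ρ + σ) (range γ) = Q.length ρ (range γ) + Q.length σ (range γ) := by
    simp [length, Finset.sum_add_distrib]
  rw [this]
  exact add_le_add (height_le_length hρ hx hy γ hγ) (height_le_length hσ hx hy γ hγ)

theorem height_le_sum_of_joinedIn (hρ : ∀ t, 0 ≤ ρ t) {x y : ℝ × ℝ} {S : Finset (ℤ × ℤ)}
    (hx : x ∈ Q.topEdge) (hy : y ∈ Q.bottomEdge) (h : JoinedIn (within Q.tiles S) y x) :
    Q.height ρ ≤ ∑ u ∈ S, Q.extend ρ u := by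
  obtain ⟨γ, hγ⟩ := h.symm
  refine (height_le_length hρ hx hy γ ?_).trans ?_
  · rintro _ ⟨s, rfl⟩
    exact (hγ s).1
  · rw [length_eq_sum]
    refine Finset.sum_le_sum_of_subset_of_nonneg (fun u hu => ?_)
      fun u _ _ => extend_nonneg hρ u
    obtain ⟨huT, v, hv, s, rfl⟩ := mem_meeting.1 hu
    exact (hγ s).2 (mem_star.2 ⟨huT, hv⟩)

/-- The constant weight 1 already has positive modulus. -/
theorem IsFatFlowOptimal.height_pos (h : Q.IsFatFlowOptimal ρ) : 0 < Q.height ρ := by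
  obtain ⟨x, hx, y, hy, γ, hγ⟩ := exists_path Q
  obtain ⟨t, ht, -⟩ := mem_region.1 (hγ γ.source_mem_range)
  have hone : Q.IsWeight 1 := ⟨fun _ => zero_le_one, fun h => by
    simpa using congrFun h ⟨t, ht⟩⟩
  have h1 : 1 ≤ Q.height 1 := by
    refine le_height fun x hx y hy γ hγ => ?_
    obtain ⟨t, ht, hxt⟩ := mem_region.1 (hγ γ.source_mem_range)
    have := Finset.single_le_sum (f := Q.extend 1)
      (fun u _ => extend_nonneg (fun _ => zero_le_one) u)
      (mem_meeting.2 ⟨ht, x, hxt, γ.source_mem_range⟩ : t ∈ Q.meeting (range γ))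
    rw [length_eq_sum]
    refine le_trans ?_ this
    simp [extend, ht]
  have h2 : 0 < Q.area 1 := by
    rw [area]
    exact Finset.sum_pos (fun _ _ => by simp) ⟨⟨t, ht⟩, Finset.mem_univ _⟩
  have h3 : 0 < Q.fatFlowModulus 1 := by
    rw [fatFlowModulus]
    positivity
  have h4 := h3.trans_le (h.2 1 hone)
  refine (height_nonneg h.1.1).lt_of_ne fun h5 => ?_
  rw [fatFlowModulus, ← h5] at h4
  simp at h4

theorem area_pos (h : Q.IsWeight ρ) : 0 < Q.area ρ := by
  obtain ⟨t, ht⟩ := Function.ne_iff.1 h.2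
  exact Finset.sum_pos' (fun _ _ => sq_nonneg _) ⟨t, Finset.mem_univ _, by
    have : ρ t ≠ 0 := ht
    positivity⟩

/-- A fat flow optimal weight function is the only weight function of at least the same height
and at most the same area. -/
theorem IsFatFlowOptimal.eq_of_area_le {σ : Q.tiles → ℝ} (h : Q.IsFatFlowOptimal ρ)
    (hσ : ∀ t, 0 ≤ σ t) (hH : Q.height ρ ≤ Q.height σ) (hA : Q.area σ ≤ Q.area ρ) : ρ = σ := by
  have hpos := h.height_pos
  have h1 := height_add_le h.1.1 hσ
  have hw : Q.IsWeight (ρ + σ) := by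
    refine ⟨fun t => add_nonneg (h.1.1 t) (hσ t), fun h0 => h.1.2 ?_⟩
    funext t
    have h2 := congrFun h0 t
    simp only [Pi.add_apply, Pi.zero_apply] at h2 ⊢
    linarith [h.1.1 t, hσ t]
  have h2 := h.2 _ hw
  have hA1 := area_pos h.1
  have hA2 := area_pos hw
  rw [fatFlowModulus, fatFlowModulus, div_le_div_iff₀ hA2 hA1] at h2
  have h3 : (2 * Q.height ρ) ^ 2 ≤ Q.height (ρ + σ) ^ 2 := by gcongr; linarith
  -- The sum `ρ + σ` has height at least `2 H`, so optimality of `ρ` bounds its area below; the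
  -- parallelogram identity then leaves no room for `ρ - σ`.
  have h4 : 4 * Q.area ρ ≤ Q.area (ρ + σ) := by
    have h5 : Q.height ρ ^ 2 * (4 * Q.area ρ) ≤ Q.height ρ ^ 2 * Q.area (ρ + σ) := by nlinarith
    exact le_of_mul_le_mul_left h5 (by positivity)
  have h5 : Q.area (ρ + σ) + ∑ t, (ρ t - σ t) ^ 2 = 2 * Q.area ρ + 2 * Q.area σ := by
    simp only [area, Finset.mul_sum, ← Finset.sum_add_distrib]
    exact Finset.sum_congr rfl fun t _ => by simp only [Pi.add_apply]; ring
  have h6 : ∑ t, (ρ t - σ t) ^ 2 = 0 :=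
    le_antisymm (by linarith) (Finset.sum_nonneg fun _ _ => sq_nonneg _)
  funext t
  have h7 := (Finset.sum_eq_zero_iff_of_nonneg fun t _ => sq_nonneg (ρ t - σ t)).1 h6 t
    (Finset.mem_univ _)
  exact sub_eq_zero.1 (pow_eq_zero_iff two_ne_zero |>.1 h7)

variable (Q ρ) in
/-- The minimal weight of the tiles met by a path from the bottom edge to the center of a tile,
capped at the height. -/
noncomputable def potential (t : ℤ × ℤ) : ℝ :=
  sInf (insert (Q.height ρ) {l | ∃ S : Finset (ℤ × ℤ), (∃ x ∈ Q.bottomEdge,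
    JoinedIn (within Q.tiles S) x (center t)) ∧ l = ∑ u ∈ S, Q.extend ρ u})

section potential

variable {S : Finset (ℤ × ℤ)} {x y : ℝ × ℝ} {s t : ℤ × ℤ}

theorem bddBelow_potential (hρ : ∀ t, 0 ≤ ρ t) : BddBelow (insert (Q.height ρ)
    {l | ∃ S : Finset (ℤ × ℤ), (∃ x ∈ Q.bottomEdge,
      JoinedIn (within Q.tiles S) x (center t)) ∧ l = ∑ u ∈ S, Q.extend ρ u}) := by
  refine BddBelow.insert _ ⟨0, ?_⟩
  rintro _ ⟨S, -, rfl⟩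
  exact Finset.sum_nonneg fun u _ => extend_nonneg hρ u

theorem potential_le_height (hρ : ∀ t, 0 ≤ ρ t) : Q.potential ρ t ≤ Q.height ρ :=
  csInf_le (bddBelow_potential hρ) (mem_insert _ _)

theorem potential_le_sum (hρ : ∀ t, 0 ≤ ρ t) (hx : x ∈ Q.bottomEdge)
    (h : JoinedIn (within Q.tiles S) x (center t)) :
    Q.potential ρ t ≤ ∑ u ∈ S, Q.extend ρ u :=
  csInf_le (bddBelow_potential hρ) (mem_insert_of_mem _ ⟨S, ⟨x, hx, h⟩, rfl⟩)

/-- The cap gives a second case, and keeps the set nonempty for tiles outside `Q`. -/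
theorem potential_induction {C : ℝ} (h1 : C ≤ Q.height ρ)
    (h2 : ∀ S : Finset (ℤ × ℤ), ∀ x ∈ Q.bottomEdge, JoinedIn (within Q.tiles S) x (center t) →
      C ≤ ∑ u ∈ S, Q.extend ρ u) : C ≤ Q.potential ρ t := by
  refine le_csInf (insert_nonempty _ _) ?_
  rintro _ (rfl | ⟨S, ⟨x, hx, h⟩, rfl⟩)
  exacts [h1, h2 S x hx h]

theorem potential_nonneg (hρ : ∀ t, 0 ≤ ρ t) : 0 ≤ Q.potential ρ t :=
  potential_induction (height_nonneg hρ) fun _ _ _ _ =>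
    Finset.sum_nonneg fun u _ => extend_nonneg hρ u

theorem sum_union_le (hρ : ∀ t, 0 ≤ ρ t) (A B : Finset (ℤ × ℤ)) :
    ∑ u ∈ A ∪ B, Q.extend ρ u ≤ ∑ u ∈ A, Q.extend ρ u + ∑ u ∈ B, Q.extend ρ u := by
  rw [← Finset.sum_union_inter]
  exact le_add_of_nonneg_right (Finset.sum_nonneg fun u _ => extend_nonneg hρ u)

theorem mem_of_joinedIn_center (ht : t ∈ Q.tiles) (h : JoinedIn (within Q.tiles S) x (center t)) :
    t ∈ S :=
  h.target_mem.2 (mem_star.2 ⟨ht, by rw [mem_tile]; simp only [center]; norm_num⟩)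

/-- A path to the center of `s` continues to that of `t` through a point in no third tile, so only
`t` is added. -/
theorem potential_le_add (hρ : ∀ t, 0 ≤ ρ t) (hst : Adjacent Q.tiles s t) :
    Q.potential ρ t ≤ Q.potential ρ s + Q.extend ρ t := by
  rw [← sub_le_iff_le_add]
  refine potential_induction ?_ fun S x hx h => ?_
  · linarith [potential_le_height (t := t) hρ, extend_nonneg hρ t]
  · have hs := mem_of_joinedIn_center hst.1 h
    have h1 : JoinedIn (within Q.tiles (S ∪ {t})) x (center t) :=
      (h.mono (within_mono Finset.subset_union_left)).trans
        (hst.joinedIn.mono (within_mono (by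
          intro u hu
          simp only [Finset.mem_insert, Finset.mem_singleton, Finset.mem_union] at hu ⊢
          rcases hu with rfl | rfl <;> simp [hs])))
    have h2 := potential_le_sum hρ hx h1
    have h3 := sum_union_le hρ S {t}
    rw [Finset.sum_singleton] at h3
    linarith

theorem potential_le_sum_star (hρ : ∀ t, 0 ≤ ρ t) (hx : x ∈ Q.bottomEdge)
    (ht : t ∈ star Q.tiles x) : Q.potential ρ t ≤ ∑ u ∈ star Q.tiles x, Q.extend ρ u :=
  potential_le_sum hρ hx (joinedIn_center (mem_star.1 ht).1 (mem_star.1 ht).2)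

/-- A path to the center of `t` continues to `x` within the star of `x`; the weight of `t` is
already counted. -/
theorem height_le_potential_add (hρ : ∀ t, 0 ≤ ρ t) (hx : x ∈ Q.topEdge)
    (ht : t ∈ star Q.tiles x) :
    Q.height ρ ≤ Q.potential ρ t + ∑ u ∈ (star Q.tiles x).erase t, Q.extend ρ u := by
  obtain ⟨htT, htx⟩ := mem_star.1 ht
  rw [← sub_le_iff_le_add]
  refine potential_induction ?_ fun S y hy h => ?_
  · exact sub_le_self _ (Finset.sum_nonneg fun u _ => extend_nonneg hρ u)
  · have hs := mem_of_joinedIn_center htT h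
    have h1 : JoinedIn (within Q.tiles (S ∪ (star Q.tiles x).erase t)) y x :=
      (h.mono (within_mono Finset.subset_union_left)).trans
        ((joinedIn_center htT htx).symm.mono (within_mono (by
          intro u hu
          by_cases hut : u = t
          · subst hut; exact Finset.mem_union_left _ hs
          · exact Finset.mem_union_right _ (Finset.mem_erase.2 ⟨hut, hu⟩))))
    have h2 := height_le_sum_of_joinedIn hρ hx hy h1
    have h3 := sum_union_le hρ S ((star Q.tiles x).erase t)
    linarith

theorem height_le_sum_star_union (hρ : ∀ t, 0 ≤ ρ t) (hx : x ∈ Q.topEdge) (hy : y ∈ Q.bottomEdge)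
    (htx : t ∈ star Q.tiles x) (hty : t ∈ star Q.tiles y) :
    Q.height ρ ≤ ∑ u ∈ star Q.tiles y ∪ star Q.tiles x, Q.extend ρ u := by
  obtain ⟨htT, htx⟩ := mem_star.1 htx
  obtain ⟨-, hty⟩ := mem_star.1 hty
  exact height_le_sum_of_joinedIn hρ hx hy
    (((joinedIn_center htT hty).mono (within_mono Finset.subset_union_left)).trans
      ((joinedIn_center htT htx).symm.mono (within_mono Finset.subset_union_right)))

end potential

/-- Points of the edges are not interior to the region. -/
theorem param_notMem_interior {b : ℝ × ℝ} (hb : b ∈ unitSquare)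
    (hb' : b.1 = 0 ∨ b.1 = 1 ∨ b.2 = 0 ∨ b.2 = 1) : Q.param b ∉ interior (region Q.tiles) := by
  rw [← Q.image_param]
  exact notMem_interior_image_unitSquare Q.continuousOn_param Q.injOn_param hb hb'

theorem notMem_interior_of_mem_topEdge {x : ℝ × ℝ} (hx : x ∈ Q.topEdge) :
    x ∉ interior (region Q.tiles) := by
  obtain ⟨b, ⟨h1, h2⟩, rfl⟩ := hx
  rw [mem_singleton_iff] at h2
  exact param_notMem_interior ⟨h1, by simp [h2]⟩ (by simp [h2])

theorem notMem_interior_of_mem_bottomEdge {x : ℝ × ℝ} (hx : x ∈ Q.bottomEdge) :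
    x ∉ interior (region Q.tiles) := by
  obtain ⟨b, ⟨h1, h2⟩, rfl⟩ := hx
  rw [mem_singleton_iff] at h2
  exact param_notMem_interior ⟨h1, by simp [h2]⟩ (by simp [h2])

theorem disjoint_topEdge_bottomEdge : Disjoint Q.topEdge Q.bottomEdge := by
  rw [Set.disjoint_left]
  rintro _ ⟨b, ⟨h1, h2⟩, rfl⟩ ⟨c, ⟨h3, h4⟩, h⟩
  rw [mem_singleton_iff] at h2 h4
  have := Q.injOn_param ⟨h3, by simp [h4]⟩ ⟨h1, by simp [h2]⟩ h
  rw [this, h2] at h4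
  exact one_ne_zero h4

/-- Two edges of a quadrilateral with a common corner meet only in this corner. -/
theorem subsingleton_image_inter (c d : ℝ) (hc : c ∈ Icc (0 : ℝ) 1) (hd : d ∈ Icc (0 : ℝ) 1) :
    (Q.param '' ({c} ×ˢ Icc 0 1) ∩ Q.param '' (Icc 0 1 ×ˢ {d})).Subsingleton := by
  have key : ∀ x ∈ Q.param '' ({c} ×ˢ Icc 0 1) ∩ Q.param '' (Icc 0 1 ×ˢ {d}),
      x = Q.param (c, d) := by
    rintro _ ⟨⟨b, ⟨h1, h2⟩, rfl⟩, ⟨e, ⟨h3, h4⟩, h⟩⟩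
    rw [mem_singleton_iff] at h1 h4
    have := Q.injOn_param ⟨h3, by rw [h4]; exact hd⟩ ⟨by rw [h1]; exact hc, h2⟩ h
    rw [← h]
    congr 1
    exact Prod.ext (by rw [this, h1]) h4
  intro x hx y hy
  rw [key x hx, key y hy]

end Quadrilateral

end SquareTiling

/-! ### Geometry of the bar -/

namespace SquareTiling

namespace Dumbbell

variable {D : Dumbbell} {s t : ℤ × ℤ} {v x y : ℝ × ℝ}

theorem mem_bar : t ∈ D.bar ↔ (D.barX ≤ t.1 ∧ t.1 < D.barX + D.barWidth) ∧
    D.barY ≤ t.2 ∧ t.2 < D.barY + D.barHeight := by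
  simp [bar, rectangle, Finset.mem_product]

theorem bar_subset_tiles : D.bar ⊆ D.tiles := by
  intro t ht
  rw [D.tiles_eq]
  exact Finset.mem_union_left _ (Finset.mem_union_right _ ht)

open Classical in
/-- The columns of the bar that do not touch the balls. -/
noncomputable def middleColumns (D : Dumbbell) : Finset ℤ :=
  (Finset.Ico D.barX (D.barX + D.barWidth)).filter fun c =>
    (D.leftBall.Nonempty → D.barX < c) ∧ (D.rightBall.Nonempty → c + 1 < D.barX + D.barWidth)

/-- The tiles of the bar in the columns that do not touch the balls. -/
noncomputable def middle (D : Dumbbell) : Finset (ℤ × ℤ) :=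
  D.middleColumns ×ˢ Finset.Ico D.barY (D.barY + D.barHeight)

theorem mem_middle : t ∈ D.middle ↔ t ∈ D.bar ∧ (D.leftBall.Nonempty → D.barX < t.1) ∧
    (D.rightBall.Nonempty → t.1 + 1 < D.barX + D.barWidth) := by
  classical
  simp only [middle, middleColumns, Finset.mem_product, Finset.mem_filter, Finset.mem_Ico, mem_bar]
  tauto

theorem middle_subset_bar : D.middle ⊆ D.bar := fun _ ht => (mem_middle.1 ht).1

/-- The balls touch the bar only along its end sides, which tiles of the middle do not reach when
the ball there is nonempty. -/
theorem mem_bar_of_mem_tile_middle (hs : s ∈ D.middle) (ht : t ∈ D.tiles) (hvs : v ∈ tile s)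
    (hvt : v ∈ tile t) : t ∈ D.bar := by
  obtain ⟨hsb, hl, hr⟩ := mem_middle.1 hs
  have hvb : v ∈ region D.bar := mem_region.2 ⟨s, hsb, hvs⟩
  obtain ⟨⟨h1, h2⟩, -⟩ := mem_tile.1 hvs
  rw [D.tiles_eq, Finset.mem_union, Finset.mem_union] at ht
  rcases ht with (ht | ht) | ht
  · exfalso
    have h3 := (D.left_inter_subset ⟨mem_region.2 ⟨t, ht, hvt⟩, hvb⟩).1
    have h4 : (D.barX : ℝ) < s.1 := by exact_mod_cast hl ⟨t, ht⟩
    rw [mem_singleton_iff] at h3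
    linarith
  · exact ht
  · exfalso
    have h3 := (D.right_inter_subset ⟨mem_region.2 ⟨t, ht, hvt⟩, hvb⟩).1
    have h4 : (s.1 : ℝ) + 1 < D.barX + D.barWidth := by exact_mod_cast hr ⟨t, ht⟩
    rw [mem_singleton_iff] at h3
    linarith

/-- Tiles adjacent to a tile in the middle of the bar are tiles of the bar with a common side. -/
theorem side_of_adjacent_middle (hs : s ∈ D.middle) (hst : Adjacent D.tiles s t) (hne : s ≠ t) :
    t ∈ D.bar ∧ (s.1 = t.1 ∧ (t.2 = s.2 + 1 ∨ s.2 = t.2 + 1) ∨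
      s.2 = t.2 ∧ (t.1 = s.1 + 1 ∨ s.1 = t.1 + 1)) := by
  obtain ⟨hsT, htT, v, hvs, hvt, hv⟩ := hst
  have htb := mem_bar_of_mem_tile_middle hs htT hvs hvt
  refine ⟨htb, ?_⟩
  obtain ⟨b1, b2, b3, b4⟩ := sub_le_one_of_mem_tile hvs hvt
  by_cases h1 : s.1 = t.1
  · have : s.2 ≠ t.2 := fun h => hne (Prod.ext h1 h)
    omega
  by_cases h2 : s.2 = t.2
  · omega
  exfalso
  -- Diagonal tiles of the bar are not adjacent: the corner tile between them is in the bar and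
  -- contains every common point.
  have h3 : ((s.1, t.2) : ℤ × ℤ) ∈ D.bar := by
    have h4 := mem_bar.1 (middle_subset_bar hs)
    have h5 := mem_bar.1 htb
    exact mem_bar.2 ⟨h4.1, h5.2⟩
  have h4 := hv (mem_star.2 ⟨bar_subset_tiles h3, mem_tile_of_diagonal hvs hvt⟩)
  rw [Finset.mem_insert, Finset.mem_singleton] at h4
  rcases h4 with h4 | h4
  · exact h2 (congrArg Prod.snd h4).symm
  · exact h1 (show ((s.1, t.2) : ℤ × ℤ).1 = t.1 by rw [h4])

theorem mem_neighbors_of_side {R : Finset (ℤ × ℤ)} (hs : s ∈ R)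
    (h : s.1 = t.1 ∧ (t.2 = s.2 + 1 ∨ s.2 = t.2 + 1) ∨
      s.2 = t.2 ∧ (t.1 = s.1 + 1 ∨ s.1 = t.1 + 1)) : s ∈ neighbors R t := by
  simp only [neighbors, Finset.mem_insert, Finset.mem_filter, Finset.mem_singleton]
  rcases h with ⟨h, h' | h'⟩ | ⟨h, h' | h'⟩
  · exact Or.inl (Prod.ext h (by simp only; omega))
  · exact Or.inr ⟨Or.inr (Or.inr (Prod.ext h h')), hs⟩
  · exact Or.inr ⟨Or.inl (Prod.ext (by simp only; omega) h), hs⟩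
  · exact Or.inr ⟨Or.inr (Or.inl (Prod.ext h' h)), hs⟩

theorem adjacent_of_mem_neighbors {T R : Finset (ℤ × ℤ)} (hRT : R ⊆ T) (ht : t ∈ R)
    (hs : s ∈ neighbors R t) : s = (t.1, t.2 - 1) ∨ s ∈ R ∧ Adjacent T s t := by
  simp only [neighbors, Finset.mem_insert, Finset.mem_filter, Finset.mem_singleton] at hs
  rcases hs with h | ⟨h, hR⟩
  · exact Or.inl h
  · refine Or.inr ⟨hR, adjacent_of_side (hRT hR) (hRT ht) ?_⟩
    rcases h with rfl | rfl | rfl <;> simp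

theorem coe_le_of_mem_bar (ht : t ∈ D.bar) (hv : v ∈ tile t) :
    ((D.barX : ℝ) ≤ v.1 ∧ v.1 ≤ D.barX + D.barWidth) ∧
      (D.barY : ℝ) ≤ v.2 ∧ v.2 ≤ D.barY + D.barHeight := by
  obtain ⟨⟨h1, h2⟩, h3, h4⟩ := mem_bar.1 ht
  obtain ⟨⟨h5, h6⟩, h7, h8⟩ := mem_tile.1 hv
  have a1 : (D.barX : ℝ) ≤ t.1 := by exact_mod_cast h1
  have a2 : (t.1 : ℝ) + 1 ≤ D.barX + D.barWidth := by exact_mod_cast h2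
  have a3 : (D.barY : ℝ) ≤ t.2 := by exact_mod_cast h3
  have a4 : (t.2 : ℝ) + 1 ≤ D.barY + D.barHeight := by exact_mod_cast h4
  refine ⟨⟨?_, ?_⟩, ?_, ?_⟩ <;> linarith

/-- The points of the middle of the bar that are not interior to the dumbbell. -/
theorem of_mem_tile_middle (ht : t ∈ D.middle) (hv : v ∈ tile t)
    (hint : v ∉ interior (region D.tiles)) : v.2 = D.barY ∨ v.2 = D.barY + D.barHeight ∨
      (D.leftBall = ∅ ∧ v.1 = D.barX) ∨ (D.rightBall = ∅ ∧ v.1 = D.barX + D.barWidth) := by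
  obtain ⟨htb, hl, hr⟩ := mem_middle.1 ht
  obtain ⟨⟨h1, h2⟩, h3, h4⟩ := coe_le_of_mem_bar htb hv
  obtain ⟨⟨h5, h6⟩, -⟩ := mem_tile.1 hv
  by_contra! hc
  obtain ⟨c1, c2, c3, c4⟩ := hc
  have d1 : v.1 ≠ D.barX := fun h => by
    rcases D.leftBall.eq_empty_or_nonempty with h0 | h0
    · exact c3 h0 h
    · have : (D.barX : ℝ) < t.1 := by exact_mod_cast hl h0
      linarith
  have d2 : v.1 ≠ D.barX + D.barWidth := fun h => by
    rcases D.rightBall.eq_empty_or_nonempty with h0 | h0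
    · exact c4 h0 h
    · have : (t.1 : ℝ) + 1 < D.barX + D.barWidth := by exact_mod_cast hr h0
      linarith
  refine hint (mem_interior.2 ⟨Ioo (D.barX : ℝ) (D.barX + D.barWidth) ×ˢ
    Ioo (D.barY : ℝ) (D.barY + D.barHeight), ?_, isOpen_Ioo.prod isOpen_Ioo,
    ⟨h1.lt_of_ne d1.symm, h2.lt_of_ne d2⟩, h3.lt_of_ne c1.symm, h4.lt_of_ne c2⟩)
  rintro w ⟨⟨e1, e2⟩, e3, e4⟩
  refine mem_region.2 ⟨(⌊w.1⌋, ⌊w.2⌋), bar_subset_tiles (mem_bar.2 ⟨⟨?_, ?_⟩, ?_, ?_⟩),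
    mem_tile.2 ⟨⟨Int.floor_le _, (Int.lt_floor_add_one _).le⟩,
      Int.floor_le _, (Int.lt_floor_add_one _).le⟩⟩
  · exact Int.le_floor.2 e1.le
  · exact Int.floor_lt.2 (by push_cast; exact e2)
  · exact Int.le_floor.2 e3.le
  · exact Int.floor_lt.2 (by push_cast; exact e4)

theorem mem_bottomEdge_of_bar {a : ℝ} (h1 : D.barX ≤ a) (h2 : a ≤ D.barX + D.barWidth) :
    (a, (D.barY : ℝ)) ∈ D.bottomEdge := D.bottom_subset ⟨⟨h1, h2⟩, rfl⟩

theorem mem_topEdge_of_bar {a : ℝ} (h1 : D.barX ≤ a) (h2 : a ≤ D.barX + D.barWidth) :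
    (a, (D.barY + D.barHeight : ℝ)) ∈ D.topEdge := D.top_subset ⟨⟨h1, h2⟩, rfl⟩

/-- By `of_mem_tile_middle` the point is on the top, the bottom, or an end of the bar without a
ball. The top is excluded by disjointness of the edges; a free end is the left or right edge of `D`,
which meets the bottom edge only in a corner. -/
theorem snd_eq_of_mem_bottomEdge (ht : t ∈ D.middle) (hv : v ∈ tile t) (hvb : v ∈ D.bottomEdge) :
    v.2 = D.barY := by
  obtain ⟨⟨h1, h2⟩, h3, h4⟩ := coe_le_of_mem_bar (middle_subset_bar ht) hv
  rcases of_mem_tile_middle ht hv (D.notMem_interior_of_mem_bottomEdge hvb) with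
    h | h | ⟨h0, h⟩ | ⟨h0, h⟩
  · exact h
  · exfalso
    refine Set.disjoint_left.1 D.disjoint_topEdge_bottomEdge ?_ hvb
    have := mem_topEdge_of_bar h1 h2
    rwa [← h] at this
  · have e1 : v ∈ D.leftEdge := by rw [D.leftEdge_of_empty h0]; exact ⟨h, h3, h4⟩
    have e2 : ((D.barX : ℝ), (D.barY : ℝ)) ∈ D.leftEdge := by
      rw [D.leftEdge_of_empty h0]; exact ⟨rfl, le_rfl, by simp⟩
    exact congrArg Prod.snd (D.subsingleton_image_inter 0 0 (by simp) (by simp)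
      ⟨e1, hvb⟩ ⟨e2, mem_bottomEdge_of_bar le_rfl (by simp)⟩)
  · have e1 : v ∈ D.rightEdge := by rw [D.rightEdge_of_empty h0]; exact ⟨h, h3, h4⟩
    have e2 : ((D.barX + D.barWidth : ℝ), (D.barY : ℝ)) ∈ D.rightEdge := by
      rw [D.rightEdge_of_empty h0]; exact ⟨rfl, le_rfl, by simp⟩
    exact congrArg Prod.snd (D.subsingleton_image_inter 1 0 (by simp) (by simp)
      ⟨e1, hvb⟩ ⟨e2, mem_bottomEdge_of_bar (by simp) le_rfl⟩)

theorem snd_eq_of_mem_topEdge (ht : t ∈ D.middle) (hv : v ∈ tile t) (hvt : v ∈ D.topEdge) :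
    v.2 = D.barY + D.barHeight := by
  obtain ⟨⟨h1, h2⟩, h3, h4⟩ := coe_le_of_mem_bar (middle_subset_bar ht) hv
  rcases of_mem_tile_middle ht hv (D.notMem_interior_of_mem_topEdge hvt) with
    h | h | ⟨h0, h⟩ | ⟨h0, h⟩
  · exfalso
    refine Set.disjoint_left.1 D.disjoint_topEdge_bottomEdge hvt ?_
    have := mem_bottomEdge_of_bar h1 h2
    rwa [← h] at this
  · exact h
  · have e1 : v ∈ D.leftEdge := by rw [D.leftEdge_of_empty h0]; exact ⟨h, h3, h4⟩
    have e2 : ((D.barX : ℝ), (D.barY + D.barHeight : ℝ)) ∈ D.leftEdge := by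
      rw [D.leftEdge_of_empty h0]; exact ⟨rfl, by simp, le_rfl⟩
    exact congrArg Prod.snd (D.subsingleton_image_inter 0 1 (by simp) (by simp)
      ⟨e1, hvt⟩ ⟨e2, mem_topEdge_of_bar le_rfl (by simp)⟩)
  · have e1 : v ∈ D.rightEdge := by rw [D.rightEdge_of_empty h0]; exact ⟨h, h3, h4⟩
    have e2 : ((D.barX + D.barWidth : ℝ), (D.barY + D.barHeight : ℝ)) ∈ D.rightEdge := by
      rw [D.rightEdge_of_empty h0]; exact ⟨rfl, by simp, le_rfl⟩
    exact congrArg Prod.snd (D.subsingleton_image_inter 1 1 (by simp) (by simp)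
      ⟨e1, hvt⟩ ⟨e2, mem_topEdge_of_bar (by simp) le_rfl⟩)

/-- A point of the bar whose first coordinate is not an integer lies in no ball. -/
theorem mem_bar_of_mem_tile_of_half (ht : t ∈ D.bar) (hs : s ∈ D.tiles) {b : ℝ}
    (hvt : ((t.1 + 1 / 2 : ℝ), b) ∈ tile t) (hvs : ((t.1 + 1 / 2 : ℝ), b) ∈ tile s) :
    s ∈ D.bar := by
  have hvb : ((t.1 + 1 / 2 : ℝ), b) ∈ region D.bar := mem_region.2 ⟨t, ht, hvt⟩
  have key : ∀ z : ℤ, (t.1 + 1 / 2 : ℝ) ≠ z := by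
    intro z h
    have h1 : ((2 * t.1 + 1 : ℤ) : ℝ) = ((2 * z : ℤ) : ℝ) := by push_cast; linarith
    norm_cast at h1
    omega
  rw [D.tiles_eq, Finset.mem_union, Finset.mem_union] at hs
  rcases hs with (hs | hs) | hs
  · exact absurd (D.left_inter_subset ⟨mem_region.2 ⟨s, hs, hvs⟩, hvb⟩).1 (key _)
  · exact hs
  · refine absurd (D.right_inter_subset ⟨mem_region.2 ⟨s, hs, hvs⟩, hvb⟩).1 ?_
    have := key (D.barX + D.barWidth)
    push_cast at this
    exact this

/-- The balls contain no bar point of half-integer abscissa, so a path can enter `t` from the bottom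
edge without meeting another tile. -/
theorem star_bottom (ht : t ∈ D.bar) (h : t.2 = D.barY) :
    star D.tiles ((t.1 + 1 / 2 : ℝ), (D.barY : ℝ)) = {t} := by
  have hvt : ((t.1 + 1 / 2 : ℝ), (D.barY : ℝ)) ∈ tile t := by
    rw [mem_tile, ← h]; norm_num
  ext u
  rw [mem_star, Finset.mem_singleton]
  refine ⟨fun ⟨huT, huv⟩ => ?_, fun hu => by rw [hu]; exact ⟨bar_subset_tiles ht, hvt⟩⟩
  have hub := mem_bar.1 (mem_bar_of_mem_tile_of_half ht huT hvt huv)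
  obtain ⟨⟨h1, h2⟩, h3, h4⟩ := mem_tile.1 huv
  simp only at h1 h2 h3
  have a1 : (u.1 : ℝ) < t.1 + 1 := by linarith
  have a2 : (t.1 : ℝ) < u.1 + 1 := by linarith
  norm_cast at a1 a2 h3
  exact Prod.ext (by omega) (by omega)

theorem star_top (ht : t ∈ D.bar) (h : t.2 + 1 = D.barY + D.barHeight) :
    star D.tiles ((t.1 + 1 / 2 : ℝ), (D.barY + D.barHeight : ℝ)) = {t} := by
  have h' : (t.2 : ℝ) + 1 = D.barY + D.barHeight := by exact_mod_cast h
  have hvt : ((t.1 + 1 / 2 : ℝ), (D.barY + D.barHeight : ℝ)) ∈ tile t := by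
    rw [mem_tile, ← h']; norm_num
  ext u
  rw [mem_star, Finset.mem_singleton]
  refine ⟨fun ⟨huT, huv⟩ => ?_, fun hu => by rw [hu]; exact ⟨bar_subset_tiles ht, hvt⟩⟩
  have hub := mem_bar.1 (mem_bar_of_mem_tile_of_half ht huT hvt huv)
  obtain ⟨⟨h1, h2⟩, h3, h4⟩ := mem_tile.1 huv
  simp only at h1 h2 h4
  have a1 : (u.1 : ℝ) < t.1 + 1 := by linarith
  have a2 : (t.1 : ℝ) < u.1 + 1 := by linarith
  norm_cast at a1 a2 h4
  exact Prod.ext (by omega) (by omega)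

theorem half_bounds (ht : t ∈ D.bar) : (D.barX : ℝ) ≤ t.1 + 1 / 2 ∧
    (t.1 + 1 / 2 : ℝ) ≤ D.barX + D.barWidth := by
  obtain ⟨⟨h1, h2⟩, -⟩ := mem_bar.1 ht
  have a1 : (D.barX : ℝ) ≤ t.1 := by exact_mod_cast h1
  have a2 : (t.1 : ℝ) + 1 ≤ D.barX + D.barWidth := by exact_mod_cast h2
  constructor <;> linarith

section weights

variable {ρ : D.tiles → ℝ}

theorem potential_le_of_bottom (hρ : ∀ t, 0 ≤ ρ t) (ht : t ∈ D.bar) (h : t.2 = D.barY) :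
    D.potential ρ t ≤ D.extend ρ t := by
  have h1 := D.potential_le_sum_star hρ
    (mem_bottomEdge_of_bar (half_bounds ht).1 (half_bounds ht).2) (t := t)
    (by rw [star_bottom ht h]; exact Finset.mem_singleton_self t)
  rwa [star_bottom ht h, Finset.sum_singleton] at h1

theorem potential_eq_of_top (hρ : ∀ t, 0 ≤ ρ t) (ht : t ∈ D.bar)
    (h : t.2 + 1 = D.barY + D.barHeight) : D.potential ρ t = D.height ρ := by
  refine le_antisymm (D.potential_le_height hρ) ?_
  have h1 := D.height_le_potential_add hρ
    (mem_topEdge_of_bar (half_bounds ht).1 (half_bounds ht).2) (t := t)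
    (by rw [star_top ht h]; exact Finset.mem_singleton_self t)
  rwa [star_top ht h, Finset.erase_singleton, Finset.sum_empty, add_zero] at h1

end weights

open Classical in
/-- The offset of a column: it is positive near the balls only. -/
noncomputable def offset (D : Dumbbell) (c : ℤ) : ℤ :=
  -- The value is at least `n + 1` in a column touching a ball, hence at least `n` in the next one,
  -- and each term is nonpositive from `n + 1` columns away.
  max 0 (max (if D.leftBall.Nonempty then D.barHeight + 1 - (c - D.barX) else 0)
    (if D.rightBall.Nonempty then D.barHeight + 1 - (D.barX + D.barWidth - 1 - c) else 0))

theorem offset_nonneg (c : ℤ) : 0 ≤ D.offset c := le_max_left _ _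

theorem abs_offset_sub_le (c : ℤ) : |D.offset (c + 1) - D.offset c| ≤ 1 := by
  rw [abs_le, offset, offset]
  split_ifs <;> omega

theorem le_offset (ht : t ∈ D.bar) (htm : t ∉ D.middle) {c : ℤ} (h1 : c ≤ t.1 + 1)
    (h2 : t.1 ≤ c + 1) : (D.barHeight : ℤ) ≤ D.offset c := by
  obtain ⟨⟨h3, h4⟩, -⟩ := mem_bar.1 ht
  rw [mem_middle] at htm
  have h5 : (D.leftBall.Nonempty ∧ t.1 = D.barX) ∨
      (D.rightBall.Nonempty ∧ t.1 + 1 = D.barX + D.barWidth) := by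
    by_contra! hc
    refine htm ⟨ht, fun h => ?_, fun h => ?_⟩
    · have := hc.1 h; omega
    · have := hc.2 h; omega
  rw [offset]
  rcases h5 with ⟨h, h'⟩ | ⟨h, h'⟩ <;> rw [if_pos h] <;> omega

end Dumbbell

end SquareTiling

/-! ### The modified weight: its area and its height -/

namespace SquareTiling

namespace Dumbbell

variable {D : Dumbbell} {ρ : D.tiles → ℝ} {s t : ℤ × ℤ} {v x y : ℝ × ℝ}

variable (D ρ) in
open Classical in
/-- The potential of a weight function, with the value zero below the bar. -/
noncomputable def barPotential (t : ℤ × ℤ) : ℝ := if t.2 < D.barY then 0 else D.potential ρ t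

variable (D ρ) in
/-- The potential of a weight function in the bar, confined between two ramps. -/
noncomputable def confined : ℤ × ℤ → ℝ :=
  confine (D.height ρ) D.barY D.barHeight D.offset (D.barPotential ρ)

variable (D ρ) in
open Classical in
/-- The potential of a weight function, confined between two ramps in the bar. -/
noncomputable def newPotential (t : ℤ × ℤ) : ℝ :=
  if t ∈ D.bar then D.confined ρ t else D.potential ρ t

variable (D ρ) in
open Classical in
/-- The weight function obtained from `ρ` by confining its potential in the bar. -/
noncomputable def newWeight (t : ℤ × ℤ) : ℝ :=
  if t ∈ D.middle then drop D.bar (D.confined ρ) t else D.extend ρ t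

theorem newWeight_nonneg (hρ : ∀ t, 0 ≤ ρ t) (t : ℤ × ℤ) : 0 ≤ D.newWeight ρ t := by
  unfold newWeight
  split_ifs
  exacts [drop_nonneg, D.extend_nonneg hρ t]

theorem barPotential_of_mem_bar (ht : t ∈ D.bar) : D.barPotential ρ t = D.potential ρ t := by
  rw [barPotential, if_neg]
  have := (mem_bar.1 ht).2.1
  omega

theorem coe_height_pos (D : Dumbbell) : (0 : ℝ) < D.barHeight := by exact_mod_cast D.barHeight_pos

/-- With offset at least `n` the upper ramp is at least `H` and the lower one at most 0 on the bar,
while the potential lies in `[0, H]`. -/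
theorem confined_of_le_offset (hρ : ∀ t, 0 ≤ ρ t) (ht : t ∈ D.bar)
    (h : (D.barHeight : ℤ) ≤ D.offset t.1) : D.confined ρ t = D.potential ρ t := by
  have hH := D.height_nonneg hρ
  have hn := D.coe_height_pos
  obtain ⟨-, h1, h2⟩ := mem_bar.1 ht
  have h' : (D.barHeight : ℝ) ≤ D.offset t.1 := by exact_mod_cast h
  have h1' : (D.barY : ℝ) ≤ t.2 := by exact_mod_cast h1
  have h2' : (t.2 : ℝ) + 1 ≤ D.barY + D.barHeight := by exact_mod_cast h2
  rw [confined, confine, barPotential_of_mem_bar ht, min_eq_left, max_eq_left]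
  · refine le_trans ?_ (D.potential_nonneg hρ)
    refine div_nonpos_of_nonpos_of_nonneg (mul_nonpos_of_nonneg_of_nonpos hH ?_) hn.le
    simp only [Pi.neg_apply, Int.cast_neg]
    linarith
  · refine (D.potential_le_height hρ).trans ?_
    rw [ramp, le_div_iff₀ hn]
    exact mul_le_mul_of_nonneg_left (by linarith) hH

theorem confined_below (hρ : ∀ t, 0 ≤ ρ t) (c : ℤ) : D.confined ρ (c, D.barY - 1) = 0 := by
  have hH := D.height_nonneg hρ
  have hn := D.coe_height_pos
  have ho : (0 : ℝ) ≤ D.offset c := by exact_mod_cast offset_nonneg c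
  rw [confined, confine, barPotential, if_pos (by simp), min_eq_left, max_eq_left]
  · refine div_nonpos_of_nonpos_of_nonneg (mul_nonpos_of_nonneg_of_nonpos hH ?_) hn.le
    simp only [Pi.neg_apply, Int.cast_neg]
    push_cast
    linarith
  · refine div_nonneg (mul_nonneg hH ?_) hn.le
    push_cast
    linarith

theorem height_le_confined (hρ : ∀ t, 0 ≤ ρ t) (ht : t ∈ D.bar)
    (h : t.2 + 1 = D.barY + D.barHeight) : D.height ρ ≤ D.confined ρ t := by
  have hH := D.height_nonneg hρ
  have hn := D.coe_height_pos
  have ho : (0 : ℝ) ≤ D.offset t.1 := by exact_mod_cast offset_nonneg t.1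
  have h' : (t.2 : ℝ) + 1 = D.barY + D.barHeight := by exact_mod_cast h
  refine le_max_of_le_left (le_min ?_ ?_)
  · rw [barPotential_of_mem_bar ht, potential_eq_of_top hρ ht h]
  · rw [ramp, le_div_iff₀ hn]
    exact mul_le_mul_of_nonneg_left (by linarith) hH

theorem newPotential_of_notMem_middle (hρ : ∀ t, 0 ≤ ρ t) (ht : t ∉ D.middle) :
    D.newPotential ρ t = D.potential ρ t := by
  unfold newPotential
  split_ifs with h
  · exact confined_of_le_offset hρ h (le_offset h ht (by omega) (by omega))
  · rfl

theorem newPotential_le_add (hρ : ∀ t, 0 ≤ ρ t) (hst : Adjacent D.tiles s t) :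
    D.newPotential ρ t ≤ D.newPotential ρ s + D.newWeight ρ t := by
  by_cases hne : s = t
  · rw [hne]
    exact le_add_of_nonneg_right (newWeight_nonneg hρ t)
  by_cases ht : t ∈ D.middle
  · obtain ⟨hsb, hside⟩ := side_of_adjacent_middle ht hst.symm (Ne.symm hne)
    rw [newPotential, newPotential, newWeight, if_pos (middle_subset_bar ht), if_pos hsb,
      if_pos ht]
    exact le_add_drop (mem_neighbors_of_side hsb (by omega))
  -- At the interface both potentials are the old ones: a middle tile adjacent to a bar tile outside
  -- the middle is still in a column of offset at least `n`.
  · have hs : D.newPotential ρ s = D.potential ρ s := by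
      by_cases hs : s ∈ D.middle
      · obtain ⟨htb, hside⟩ := side_of_adjacent_middle hs hst hne
        rw [newPotential, if_pos (middle_subset_bar hs)]
        exact confined_of_le_offset hρ (middle_subset_bar hs)
          (le_offset htb ht (by omega) (by omega))
      · exact newPotential_of_notMem_middle hρ hs
    rw [hs, newPotential_of_notMem_middle hρ ht, newWeight, if_neg ht]
    exact D.potential_le_add hρ hst

theorem newPotential_le_of_bottom (hρ : ∀ t, 0 ≤ ρ t) (ht : t ∈ D.bar) (h : t.2 = D.barY) :
    D.newPotential ρ t ≤ D.newWeight ρ t := by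
  by_cases htm : t ∈ D.middle
  · rw [newPotential, newWeight, if_pos ht, if_pos htm]
    have h1 := le_add_drop (f := D.confined ρ) (below_mem_neighbors D.bar t.1 t.2)
    rwa [h, confined_below hρ, zero_add, ← h] at h1
  · rw [newPotential_of_notMem_middle hρ htm, newWeight, if_neg htm]
    exact potential_le_of_bottom hρ ht h

/-- The old weight is compatible with its potential and `drop` is the least such weight, so the
column energy of the potential is at most the old area of the column. -/
theorem drop_barPotential_le (hρ : ∀ t, 0 ≤ ρ t) (ht : t ∈ D.bar) :
    drop D.bar (D.barPotential ρ) t ≤ D.extend ρ t := by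
  refine drop_le (D.extend_nonneg hρ t) fun s hs => ?_
  rw [barPotential_of_mem_bar ht]
  have key : ∀ s ∈ D.bar, Adjacent D.tiles s t →
      D.potential ρ t ≤ D.barPotential ρ s + D.extend ρ t := fun s hsb hst => by
    rw [barPotential_of_mem_bar hsb]
    exact D.potential_le_add hρ hst
  rcases adjacent_of_mem_neighbors bar_subset_tiles ht hs with rfl | ⟨hsb, hst⟩
  · obtain ⟨h1, h2, h3⟩ := mem_bar.1 ht
    rcases h2.eq_or_lt with h | h
    · rw [barPotential, if_pos (by simp only; omega), zero_add]
      exact potential_le_of_bottom hρ ht h.symm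
    · have hb : (t.1, t.2 - 1) ∈ D.bar := mem_bar.2 ⟨h1, by simp only; omega, by simp only; omega⟩
      exact key _ hb (adjacent_of_side (bar_subset_tiles hb) (bar_subset_tiles ht) (by simp))
  · exact key s hsb hst

theorem sum_newWeight_sq_le (hρ : ∀ t, 0 ≤ ρ t) :
    ∑ t ∈ D.tiles, D.newWeight ρ t ^ 2 ≤ ∑ t ∈ D.tiles, D.extend ρ t ^ 2 := by
  have hsub : D.middle ⊆ D.tiles := middle_subset_bar.trans bar_subset_tiles
  rw [← Finset.sum_sdiff hsub, ← Finset.sum_sdiff hsub]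
  refine add_le_add (le_of_eq (Finset.sum_congr rfl fun t ht => ?_)) ?_
  · rw [newWeight, if_neg (Finset.mem_sdiff.1 ht).2]
  · have h1 : ∑ t ∈ D.middle, D.newWeight ρ t ^ 2 =
        ∑ t ∈ D.middle, drop D.bar (D.confined ρ) t ^ 2 :=
      Finset.sum_congr rfl fun t ht => by rw [newWeight, if_pos ht]
    rw [h1, middle, Finset.sum_product, Finset.sum_product]
    refine Finset.sum_le_sum fun c hc => ?_
    have hbar : ∀ j ∈ Finset.Ico D.barY (D.barY + D.barHeight), (c, j) ∈ D.bar := fun j hj =>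
      middle_subset_bar (Finset.mem_product.2 ⟨hc, hj⟩)
    have hn := D.barHeight_pos
    have htop : D.barPotential ρ (c, D.barY + D.barHeight - 1) = D.height ρ := by
      have hb := hbar (D.barY + D.barHeight - 1) (Finset.mem_Ico.2 (by omega))
      rw [barPotential_of_mem_bar hb, potential_eq_of_top hρ hb (by simp)]
    refine (sum_drop_confine_sq_le (D.height_nonneg hρ) c D.barY hn abs_offset_sub_le
      (offset_nonneg c) (by simp [barPotential]) htop).trans ?_
    exact Finset.sum_le_sum fun j hj =>
      pow_le_pow_left₀ drop_nonneg (drop_barPotential_le hρ (hbar j hj)) 2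

/-- The star of a point of the bottom edge that contains a tile in the middle of the bar consists
of tiles in the bottom row of the bar, whose new potential is at most their new weight. -/
theorem newPotential_le_of_mem_star (hρ : ∀ t, 0 ≤ ρ t) (hy : y ∈ D.bottomEdge)
    (h : ∃ s ∈ star D.tiles y, s ∈ D.middle) (ht : t ∈ star D.tiles y) :
    D.newPotential ρ t ≤ D.newWeight ρ t := by
  obtain ⟨s, hs, hsm⟩ := h
  rw [mem_star] at hs ht
  have htb := mem_bar_of_mem_tile_middle hsm ht.1 hs.2 ht.2
  have h1 := snd_eq_of_mem_bottomEdge hsm hs.2 hy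
  have h2 := (mem_tile.1 ht.2).2.1
  rw [h1] at h2
  norm_cast at h2
  exact newPotential_le_of_bottom hρ htb (le_antisymm h2 (mem_bar.1 htb).2.1)

theorem newPotential_le_sum_star (hρ : ∀ t, 0 ≤ ρ t) (hy : y ∈ D.bottomEdge)
    (ht : t ∈ star D.tiles y) :
    D.newPotential ρ t ≤ ∑ u ∈ star D.tiles y, D.newWeight ρ u := by
  by_cases h : ∃ s ∈ star D.tiles y, s ∈ D.middle
  · exact (newPotential_le_of_mem_star hρ hy h ht).trans
      (Finset.single_le_sum (f := D.newWeight ρ) (fun u _ => newWeight_nonneg hρ u) ht)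
  · push Not at h
    rw [newPotential_of_notMem_middle hρ (h t ht),
      Finset.sum_congr rfl fun u hu => by rw [newWeight, if_neg (h u hu)]]
    exact D.potential_le_sum_star hρ hy ht

/-- Tiles are collected along the path from the star of `y` until the star of `x` is reached; the
new potential stays below the collected new weight. -/
theorem le_sum_newWeight (hρ : ∀ t, 0 ≤ ρ t) (hx : x ∈ D.topEdge) (hy : y ∈ D.bottomEdge)
    (γ : Path x y) (hγ : range γ ⊆ D.carrier) :
    D.height ρ ≤ ∑ t ∈ D.meeting (range γ), D.newWeight ρ t := by
  have hw := newWeight_nonneg (ρ := ρ) hρ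
  set S := D.meeting (range γ)
  have hstar : ∀ v ∈ range γ, star D.tiles v ⊆ S := fun v hv u hu =>
    Quadrilateral.mem_meeting.2 ⟨(mem_star.1 hu).1, v, (mem_star.1 hu).2, hv⟩
  have hxS := hstar x γ.source_mem_range
  have hyS := hstar y γ.target_mem_range
  have hyne : (star D.tiles y).Nonempty := by
    obtain ⟨t, ht, hyt⟩ := mem_region.1 (hγ γ.target_mem_range)
    exact ⟨t, mem_star.2 ⟨ht, hyt⟩⟩
  have hxne : (star D.tiles x).Nonempty := by
    obtain ⟨t, ht, hxt⟩ := mem_region.1 (hγ γ.source_mem_range)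
    exact ⟨t, mem_star.2 ⟨ht, hxt⟩⟩
  have hmono : ∀ A ⊆ S, ∑ u ∈ A, D.newWeight ρ u ≤ ∑ u ∈ S, D.newWeight ρ u := fun A hA =>
    Finset.sum_le_sum_of_subset_of_nonneg hA fun u _ _ => hw u
  have main : ∀ X ⊆ S, X.Nonempty → Disjoint (star D.tiles y) X →
      ∃ t ∈ X, D.newPotential ρ t + ∑ u ∈ X.erase t, D.newWeight ρ u ≤
        ∑ u ∈ S, D.newWeight ρ u := fun X hXS hX hd =>
    exists_potential_add_sum_le (adj := Adjacent D.tiles) hw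
      (fun s t h => newPotential_le_add hρ h) hyS
      (fun t ht => newPotential_le_sum_star hρ hy ht)
      (fun A hBA hAS hne => exists_adjacent_of_isPreconnected
        (isPreconnected_range γ.continuous) hγ hstar
        (fun t ht => Quadrilateral.mem_meeting.1 ht) (hyne.mono hBA) hAS hne) hXS hX hd
  -- If `x` touches a middle tile, that tile is in the top row, where the confined potential is at
  -- least `H`. Otherwise all weights at `x` are old ones and `height_le_potential_add` finishes.
  by_cases h : ∃ s ∈ star D.tiles x, s ∈ D.middle
  · obtain ⟨s, hsx, hsm⟩ := h
    have hsb := middle_subset_bar hsm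
    have hs2 : s.2 + 1 = D.barY + D.barHeight := by
      have h1 := snd_eq_of_mem_topEdge hsm (mem_star.1 hsx).2 hx
      have h2 := (mem_tile.1 (mem_star.1 hsx).2).2.2
      rw [h1] at h2
      norm_cast at h2
      have := (mem_bar.1 hsb).2.2
      omega
    have hHs : D.height ρ ≤ D.newPotential ρ s := by
      rw [newPotential, if_pos hsb]
      exact height_le_confined hρ hsb hs2
    by_cases hsy : s ∈ star D.tiles y
    · exact hHs.trans ((newPotential_le_sum_star hρ hy hsy).trans (hmono _ hyS))
    · obtain ⟨t, ht, h1⟩ := main {s} (Finset.singleton_subset_iff.2 (hxS hsx))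
        (Finset.singleton_nonempty s) (Finset.disjoint_singleton_right.2 hsy)
      rw [Finset.mem_singleton] at ht
      subst ht
      rw [Finset.erase_singleton, Finset.sum_empty, add_zero] at h1
      exact hHs.trans h1
  · push Not at h
    have hfin : ∀ t ∈ star D.tiles x, D.height ρ ≤
        D.newPotential ρ t + ∑ u ∈ (star D.tiles x).erase t, D.newWeight ρ u := fun t ht => by
      rw [newPotential_of_notMem_middle hρ (h t ht), Finset.sum_congr rfl fun u hu => by
        rw [newWeight, if_neg (h u (Finset.mem_of_mem_erase hu))]]
      exact D.height_le_potential_add hρ hx ht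
    by_cases hd : Disjoint (star D.tiles y) (star D.tiles x)
    · obtain ⟨t, ht, h1⟩ := main _ hxS hxne hd
      exact (hfin t ht).trans h1
    -- When the two stars share a tile there is no first entry, and the bound comes from this tile
    -- directly.
    · obtain ⟨t, hty, htx⟩ := Finset.not_disjoint_iff.1 hd
      by_cases hm : ∃ s ∈ star D.tiles y, s ∈ D.middle
      · have h1 := newPotential_le_of_mem_star hρ hy hm hty
        have h2 := hmono _ hxS
        rw [← Finset.add_sum_erase _ _ htx] at h2
        linarith [hfin t htx]
      · push Not at hm
        refine le_trans ?_ (hmono _ (Finset.union_subset hyS hxS))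
        rw [Finset.sum_congr rfl fun u hu => by
          rw [newWeight, if_neg ((Finset.mem_union.1 hu).elim (hm u) (h u))]]
        exact D.height_le_sum_star_union hρ hx hy htx hty

theorem confined_of_offset_eq_zero (h : D.offset t.1 = 0) :
    D.confined ρ t = ramp (D.height ρ) D.barY D.barHeight (-D.offset) t := by
  have : ramp (D.height ρ) D.barY D.barHeight D.offset t =
      ramp (D.height ρ) D.barY D.barHeight (-D.offset) t := by simp [ramp, h]
  rw [confined, confine, this]
  exact max_eq_right (min_le_right _ _)

theorem newWeight_of_offset_eq_zero (hρ : ∀ t, 0 ≤ ρ t) (ht : t ∈ D.middle)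
    (h : D.offset t.1 = 0) : D.newWeight ρ t = D.height ρ / D.barHeight := by
  have hH := D.height_nonneg hρ
  have hn := D.coe_height_pos
  have ho : ∀ c, |(-D.offset) (c + 1) - (-D.offset) c| ≤ 1 := fun c => by
    rw [abs_sub_comm]
    simpa [add_comm, sub_eq_add_neg] using abs_offset_sub_le (D := D) c
  rw [newWeight, if_pos ht]
  refine le_antisymm (drop_le (by positivity) fun s hs => ?_) ?_
  · rw [confined_of_offset_eq_zero h]
    have h1 := le_add_drop (f := ramp (D.height ρ) D.barY D.barHeight (-D.offset)) hs
    have h2 := drop_ramp_le (R := D.bar) (t := t) hH (y := D.barY) (n := D.barHeight) ho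
    -- At `t` the confined potential is the lower ramp, and at neighbors it is at least this ramp,
    -- so the drop is at most that of the ramp. Equality comes from the tile below, in the same
    -- column.
    have h3 : ramp (D.height ρ) D.barY D.barHeight (-D.offset) s ≤ D.confined ρ s :=
      le_max_right _ _
    linarith
  · have h1 := le_add_drop (f := D.confined ρ) (below_mem_neighbors D.bar t.1 t.2)
    rw [confined_of_offset_eq_zero (t := (t.1, t.2)) h,
      confined_of_offset_eq_zero (t := (t.1, t.2 - 1)) h, ← sub_le_iff_le_add'] at h1
    refine le_trans (le_of_eq ?_) h1
    rw [ramp, ramp, ← sub_div]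
    push_cast
    ring

theorem tile_inter_nonempty (h1 : s.1 ≤ t.1 + 1) (h2 : t.1 ≤ s.1 + 1) (h3 : s.2 ≤ t.2 + 1)
    (h4 : t.2 ≤ s.2 + 1) : (tile s ∩ tile t).Nonempty := by
  have h1' : (s.1 : ℝ) ≤ t.1 + 1 := by exact_mod_cast h1
  have h2' : (t.1 : ℝ) ≤ s.1 + 1 := by exact_mod_cast h2
  have h3' : (s.2 : ℝ) ≤ t.2 + 1 := by exact_mod_cast h3
  have h4' : (t.2 : ℝ) ≤ s.2 + 1 := by exact_mod_cast h4
  refine ⟨(max (s.1 : ℝ) t.1, max (s.2 : ℝ) t.2), mem_tile.2 ?_, mem_tile.2 ?_⟩ <;>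
    simp [h1', h2', h3', h4']

theorem skinnyDist_le {B : Set (ℝ × ℝ)} {k : ℕ} (ht : t ∈ D.bar) (hs : s ∈ D.bar)
    (hsB : (tile s ∩ B).Nonempty) (h1 : |t.1 - s.1| ≤ k) (h2 : |t.2 - s.2| ≤ k) :
    D.skinnyDist (interior (tile t)) B ≤ k := by
  -- A chain of king moves: after `i` steps each coordinate has moved towards `s` by at most `i`, so
  -- the chain stays in the bar.
  set step : ℕ → ℤ × ℤ := fun i =>
    (max (t.1 - i) (min (t.1 + i) s.1), max (t.2 - i) (min (t.2 + i) s.2)) with hstep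
  have hmem : ∀ i, step i ∈ D.bar := fun i => by
    have h3 := mem_bar.1 ht
    have h4 := mem_bar.1 hs
    rw [mem_bar]
    simp only [hstep]
    omega
  have h0 : step 0 = t := by
    simp only [hstep]
    exact Prod.ext (by simp) (by simp)
  have hk : step k = s := by
    rw [abs_le] at h1 h2
    simp only [hstep]
    exact Prod.ext (by simp only; omega) (by simp only; omega)
  refine (iInf₂_le ((List.range (k + 1)).map step) ⟨?_, ?_, ?_, ?_⟩).trans (by simp)
  · intro u hu
    obtain ⟨i, -, rfl⟩ := List.mem_map.1 hu
    exact bar_subset_tiles (hmem i)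
  · rw [List.isChain_map]
    refine (List.isChain_range_succ _ k).2 fun i _ => ?_
    refine tile_inter_nonempty ?_ ?_ ?_ ?_ <;> simp only [hstep] <;> push_cast <;> omega
  · refine ⟨t, by simp [List.head?_range, h0], ?_⟩
    have hc : center t ∈ interior (tile t) := by
      rw [tile, interior_prod_eq, interior_Icc, interior_Icc, center]
      refine ⟨⟨?_, ?_⟩, ?_, ?_⟩ <;> simp only <;> linarith
    exact ⟨center t, interior_subset hc, hc⟩
  · refine ⟨s, by simp [List.range_succ, hk], hsB⟩

/-- Tiles of the bar that are far from the balls are in columns that are far from the balls. -/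
theorem le_of_le_skinnyDist (ht : t ∈ D.bar)
    (h : ((3 * D.barHeight : ℕ) : ℕ∞) ≤ D.skinnyDist (interior (tile t)) D.balls) :
    (D.leftBall.Nonempty → D.barX + 3 * D.barHeight ≤ t.1) ∧
      (D.rightBall.Nonempty → t.1 + 3 * D.barHeight + 1 ≤ D.barX + D.barWidth) := by
  have hn := D.barHeight_pos
  have htb := mem_bar.1 ht
  -- Rows of the bar differ by at most `n - 1`, below `3 n`, so the distance to a bar tile touching
  -- a ball must be horizontal.
  have key : ∀ s ∈ D.bar, (tile s ∩ D.balls).Nonempty → 3 * (D.barHeight : ℤ) ≤ |t.1 - s.1| := by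
    intro s hs hsB
    by_contra! hlt
    have hsb := mem_bar.1 hs
    have h1 := h.trans (skinnyDist_le (k := 3 * D.barHeight - 1) ht hs hsB (by omega)
      (abs_le.2 ⟨by omega, by omega⟩))
    rw [Nat.cast_le] at h1
    omega
  constructor
  · intro hl
    obtain ⟨z, hzl, hzb⟩ := (D.left_inter_connected hl).nonempty
    have hz : z.1 = D.barX := (D.left_inter_subset ⟨hzl, hzb⟩).1
    obtain ⟨s, hs, hzs⟩ := mem_region.1 hzb
    have h1 := (mem_tile.1 hzs).1.1
    rw [hz] at h1
    norm_cast at h1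
    have h2 := key s hs ⟨z, hzs, Or.inl hzl⟩
    have h3 := (mem_bar.1 hs).1.1
    have h4 : s.1 = D.barX := le_antisymm h1 h3
    rw [h4, abs_of_nonneg (by omega)] at h2
    omega
  · intro hr
    obtain ⟨z, hzr, hzb⟩ := (D.right_inter_connected hr).nonempty
    have hz : z.1 = D.barX + D.barWidth := (D.right_inter_subset ⟨hzr, hzb⟩).1
    obtain ⟨s, hs, hzs⟩ := mem_region.1 hzb
    have h1 := (mem_tile.1 hzs).1.2
    rw [hz] at h1
    norm_cast at h1
    have h2 := key s hs ⟨z, hzs, Or.inr hzr⟩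
    have h3 := (mem_bar.1 hs).1.2
    have h4 : s.1 = D.barX + D.barWidth - 1 := by omega
    rw [h4, abs_of_nonpos (by omega)] at h2
    omega

theorem extend_newWeight : D.extend (fun u : D.tiles => D.newWeight ρ u) = D.newWeight ρ := by
  funext u
  unfold Quadrilateral.extend
  split_ifs with hu
  · rfl
  · rw [newWeight, if_neg fun h => hu (bar_subset_tiles (middle_subset_bar h)),
      Quadrilateral.extend, dif_neg hu]

end Dumbbell

end SquareTiling

open SquareTiling Dumbbell in
theorem mainTheorem1 (D : SquareTiling.Dumbbell) (ρ : D.tiles → ℝ)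
    (hρ : D.IsFatFlowOptimal ρ) : D.IsVirtuallyBarUniform ρ := by
  intro t ht hdist
  have hρ0 := hρ.1.1
  have heq : ρ = fun u : D.tiles => D.newWeight ρ u := by
    refine hρ.eq_of_area_le (fun u => newWeight_nonneg hρ0 u) ?_ ?_
    · refine D.le_height fun x hx y hy γ hγ => ?_
      rw [Quadrilateral.length_eq_sum, extend_newWeight]
      exact le_sum_newWeight hρ0 hx hy γ hγ
    · rw [Quadrilateral.area_eq_sum, Quadrilateral.area_eq_sum, extend_newWeight]
      exact sum_newWeight_sq_le hρ0
  have hn := D.barHeight_pos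
  obtain ⟨hl, hr⟩ := le_of_le_skinnyDist ht hdist
  have hm : t.1 ∈ D.middle := mem_middle.2
    ⟨ht, fun h => by have := hl h; omega, fun h => by have := hr h; omega⟩
  -- A distance of `3 n` columns is at least the `n + 1` at which the offset vanishes, as `n ≥ 1`.
  have ho : D.offset t.1.1 = 0 := by
    rw [offset]
    split_ifs with h1 h2 h2
    · have := hl h1; have := hr h2; omega
    · have := hl h1; omega
    · have := hr h2; omega
    · omega
  have hw := newWeight_of_offset_eq_zero hρ0 hm ho
  rw [← hw]
  exact congrFun heq t
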